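/- Let $k$ be a field and let $p,q\in k^*=k\setminus\{0\}$. Let $A=\mathcal{O}_{p,q}(\mathrm{SL}_2(k))$ be the $k$-algebra presented by generators $a,b,c,d$ and relations $$ba=q\,ab,\quad ca=p\,ac,\quad db=q\,bd,\quad dc=p\,cd,\quad bc=cb,\quad ad-p^{-1}bc=1=da-q\,bc.$$ Then the Hochschild cohomological dimension of $A$, that is, the projective dimension of $A$ in the category of $A$-bimodules (left modules over $A\otimes_k A^{\mathrm{op}}$), equals $3$. Moreover, $A$ is smooth, that is, for some $n\ge 0$ there is an exact sequence of $A$-bimodules $$0\to P_n\to\cdots\to P_1\to P_0\to A\to 0$$ in which every $P_i$ is a finitely generated projective $A$-bimodule. -/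

import Mathlib

open scoped TensorProduct

namespace BraidedSL2

/-- The four generators `a, b, c, d`. -/
inductive Gen : Type
  | a | b | c | d

section Algebra

universe u

variable {k : Type u} [Field k]

/-- The generator `g`, as an element of the free algebra on `a, b, c, d`. -/
abbrev gen (k : Type u) [Field k] (g : Gen) : FreeAlgebra k Gen := FreeAlgebra.ι k g

/-- The defining relations of the coordinate algebra of the two-parameter braided quantum
group `SL₂`. -/
inductive Rel (p q : kˣ) : FreeAlgebra k Gen → FreeAlgebra k Gen → Prop
  | ba : Rel p q (gen k .b * gen k .a) ((q : k) • (gen k .a * gen k .b))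
  | ca : Rel p q (gen k .c * gen k .a) ((p : k) • (gen k .a * gen k .c))
  | db : Rel p q (gen k .d * gen k .b) ((q : k) • (gen k .b * gen k .d))
  | dc : Rel p q (gen k .d * gen k .c) ((p : k) • (gen k .c * gen k .d))
  | bc : Rel p q (gen k .b * gen k .c) (gen k .c * gen k .b)
  | ad : Rel p q
      (gen k .a * gen k .d - ((p⁻¹ : kˣ) : k) • (gen k .b * gen k .c)) 1
  | da : Rel p q
      (gen k .d * gen k .a - (q : k) • (gen k .b * gen k .c)) 1

/-- The algebra `𝒪_{p,q}(SL₂(k))`: the quotient of the free `k`-algebra on `a, b, c, d` by the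
two-sided ideal generated by the relations. -/
abbrev OSL2 (p q : kˣ) : Type u := RingQuot (Rel p q)

end Algebra

section Homological

universe u v

/-- An algebra `A` as a bimodule over itself. Bimodules over the `k`-algebra `A` (with central
action of `k`) are left modules over the enveloping algebra `A ⊗[k] Aᵐᵒᵖ`, and
`(x ⊗ op y)` acts on `A` by `z ↦ x * z * y`. -/
noncomputable def regularBimodule (k : Type u) [Field k] (A : Type v) [Ring A] [Algebra k A] :
    ModuleCat.{v} (A ⊗[k] Aᵐᵒᵖ) :=
  letI : Module (A ⊗[k] Aᵐᵒᵖ) A := TensorProduct.Algebra.module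
  ModuleCat.of (A ⊗[k] Aᵐᵒᵖ) A

/-- The Hochschild cohomological dimension of `A`: the projective dimension of `A` in the
category of `A`-bimodules. -/
noncomputable def hochschildCohomologicalDimension (k : Type u) [Field k] (A : Type v) [Ring A]
    [Algebra k A] : WithBot ℕ∞ :=
  CategoryTheory.projectiveDimension (regularBimodule k A)

/-- A module `M` is of type FP if there is an exact sequence
`0 → Pₙ → ⋯ → P₁ → P₀ → M → 0` with every `Pᵢ` finitely generated and projective.
The sequence is extended by zero modules above the degree `n`. -/
def IsTypeFP (R : Type v) [Ring R] (M : ModuleCat.{v} R) : Prop :=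
  ∃ (P : ℕ → ModuleCat.{v} R) (d : ∀ i, P (i + 1) →ₗ[R] P i) (π : P 0 →ₗ[R] M),
    (∀ i, Module.Finite R (P i) ∧ Module.Projective R (P i)) ∧
    (∃ n : ℕ, ∀ i, n < i → Subsingleton (P i)) ∧
    Function.Surjective π ∧
    Function.Exact (d 0) π ∧
    ∀ i, Function.Exact (d (i + 1)) (d i)

/-- A `k`-algebra `A` is (homologically) smooth if it is of type FP as an `A`-bimodule. -/
def IsHomologicallySmooth (k : Type u) [Field k] (A : Type v) [Ring A] [Algebra k A] : Prop :=
  IsTypeFP (A ⊗[k] Aᵐᵒᵖ) (regularBimodule k A)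

end Homological

end BraidedSL2

/-! Put `E = A ⊗ Aᵐᵒᵖ` and write primes for the right factor. Two classical matrices of determinant
one with the same first row `(a, b)` satisfy `(c', d') = (c, d) - t (a, b)` with `t = cd' - dc'`. So
the diagonal of `SL₂ × SL₂` is cut out by three equations: `a = a'`, `b = b'`, `t = 0`. Their
quantum analogues `alpha`, `beta`, `gamma` generate the kernel of multiplication `E → A` as a left
ideal (`exact_augmentation`). They commute up to scalar twists and one correction term, a multiple
of `c ⊗ c` (`beta_alpha`, `beta_minor`, `alpha_minor`). Once they are known to be regular, a twisted
Koszul complex `0 → E → E³ → E³ → E` resolves `A`, which gives smoothness and the upper bound.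

Regularity of `beta`, and of `alpha` modulo `beta`, is a leading term argument for gradings of `E`
(`mem_of_mul_leading_mem`). It reduces to `a` and `b` being non-zero-divisors on the appropriate
sides, which is read off from an action of `A` on a normal form model. Regularity of `gamma` modulo
the other two (`mem_of_mul_gamma`) follows the geometry: `E / (E alpha + E beta)` embeds in a
twisted polynomial module `A[t]`, on which multiplication by `gamma` becomes the injective shift.

For the lower bound, the entries of the last differential are killed by an algebra map `E → k`. That
differential therefore has no retraction, and the projective dimension cannot drop below three. -/

namespace BraidedSL2

universe u v

/-! ### The relations, the universal property, and the torus action. -/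

section Presentation

variable {k : Type u} [Field k]

/-- Four elements of a `k`-algebra satisfying the defining relations of `OSL2 p q`. -/
structure IsMatrixTuple {B : Type v} [Ring B] [Algebra k B] (p q : kˣ) (x : Gen → B) : Prop where
  ba : x .b * x .a = (q : k) • (x .a * x .b)
  ca : x .c * x .a = (p : k) • (x .a * x .c)
  db : x .d * x .b = (q : k) • (x .b * x .d)
  dc : x .d * x .c = (p : k) • (x .c * x .d)
  bc : x .b * x .c = x .c * x .b
  ad : x .a * x .d = 1 + (p⁻¹ : k) • (x .b * x .c)
  da : x .d * x .a = 1 + (q : k) • (x .b * x .c)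

theorem IsMatrixTuple.map {B C : Type*} [Ring B] [Algebra k B] [Ring C] [Algebra k C] {p q : kˣ}
    {x : Gen → B} (h : IsMatrixTuple p q x) (φ : B →ₐ[k] C) :
    IsMatrixTuple p q (fun g => φ (x g)) where
  ba := by rw [← map_mul, h.ba, map_smul, map_mul]
  ca := by rw [← map_mul, h.ca, map_smul, map_mul]
  db := by rw [← map_mul, h.db, map_smul, map_mul]
  dc := by rw [← map_mul, h.dc, map_smul, map_mul]
  bc := by rw [← map_mul, h.bc, map_mul]
  ad := by rw [← map_mul, h.ad, map_add, map_smul, map_mul, map_one]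
  da := by rw [← map_mul, h.da, map_add, map_smul, map_mul, map_one]

/-- The torus acts on tuples of matrix entries. -/
theorem IsMatrixTuple.scale {B : Type*} [Ring B] [Algebra k B] {p q : kˣ}
    {x : Gen → B} (h : IsMatrixTuple p q x) (w : Gen → kˣ) (had : w .a * w .d = 1)
    (hbc : w .b * w .c = 1) : IsMatrixTuple p q (fun g => (w g : k) • x g) := by
  have had' : (w .a : k) * w .d = 1 := by rw [← Units.val_mul, had, Units.val_one]
  have hbc' : (w .b : k) * w .c = 1 := by rw [← Units.val_mul, hbc, Units.val_one]
  have hda' : (w .d : k) * w .a = 1 := by rw [mul_comm, had']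
  have hcb' : (w .c : k) * w .b = 1 := by rw [mul_comm, hbc']
  constructor <;> simp only [smul_mul_smul_comm, had', hbc', hda', hcb', one_smul, h.ba, h.ca, h.db, h.dc,
    h.ad, h.da, h.bc, smul_smul] <;> congr 1 <;> ring

/-- The relations satisfied by a tuple whose opposite satisfies the defining relations. -/
theorem IsMatrixTuple.of_op {B : Type*} [Ring B] [Algebra k B] {p q : kˣ} {x : Gen → B}
    (h : IsMatrixTuple p q (fun g => MulOpposite.op (x g))) :
    x .a * x .b = (q : k) • (x .b * x .a) ∧ x .a * x .c = (p : k) • (x .c * x .a) ∧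
    x .b * x .d = (q : k) • (x .d * x .b) ∧ x .c * x .d = (p : k) • (x .d * x .c) ∧
    x .c * x .b = x .b * x .c ∧ x .d * x .a = 1 + (p⁻¹ : k) • (x .c * x .b) ∧
    x .a * x .d = 1 + (q : k) • (x .c * x .b) :=
  ⟨MulOpposite.op_injective h.ba, MulOpposite.op_injective h.ca, MulOpposite.op_injective h.db,
    MulOpposite.op_injective h.dc, MulOpposite.op_injective h.bc, MulOpposite.op_injective h.ad,
    MulOpposite.op_injective h.da⟩

/-- The weights of the torus element `(s, r)` on the generators. -/
def weight (s r : kˣ) : Gen → kˣ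
  | .a => s
  | .b => r
  | .c => r⁻¹
  | .d => s⁻¹

/-- An algebra is freely generated by a tuple subject to the relations of `OSL2 p q`. -/
structure IsUniversalTuple {A : Type u} [Ring A] [Algebra k A] (p q : kˣ) (e : Gen → A) :
    Prop where
  isMatrixTuple : IsMatrixTuple p q e
  exists_lift : ∀ {B : Type u} [Ring B] [Algebra k B] (x : Gen → B), IsMatrixTuple p q x →
    ∃ φ : A →ₐ[k] B, ∀ g, φ (e g) = x g
  subalgebra_eq_top : ∀ S : Subalgebra k A, (∀ g, e g ∈ S) → S = ⊤

namespace IsUniversalTuple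

variable {A : Type u} [Ring A] [Algebra k A] {p q : kˣ} {e : Gen → A}
  (h : IsUniversalTuple p q e) {B : Type u} [Ring B] [Algebra k B]

/-- The algebra map given by a tuple satisfying the relations. -/
noncomputable def lift (x : Gen → B) (hx : IsMatrixTuple p q x) : A →ₐ[k] B :=
  (h.exists_lift x hx).choose

@[simp]
theorem lift_entry (x : Gen → B) (hx : IsMatrixTuple p q x) (g : Gen) :
    h.lift x hx (e g) = x g :=
  (h.exists_lift x hx).choose_spec g

/-- Induction on elements of `A`. -/
theorem induction (h : IsUniversalTuple p q e) {P : A → Prop} (scalar : ∀ r : k, P (algebraMap k _ r))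
    (entry : ∀ g, P (e g)) (mul : ∀ x y, P x → P y → P (x * y))
    (add : ∀ x y, P x → P y → P (x + y)) (x : A) : P x := by
  let S : Subalgebra k A :=
    { carrier := {x | P x}
      mul_mem' := fun {x y} hx hy => mul x y hx hy
      add_mem' := fun {x y} hx hy => add x y hx hy
      algebraMap_mem' := scalar }
  have hS : S = ⊤ := h.subalgebra_eq_top S entry
  have hx : x ∈ S := hS ▸ Algebra.mem_top
  exact hx

theorem hom_ext (h : IsUniversalTuple p q e) {C : Type*} [Ring C] [Algebra k C] {φ ψ : A →ₐ[k] C}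
    (hφ : ∀ g, φ (e g) = ψ (e g)) : φ = ψ := by
  ext x
  have hx : x ∈ AlgHom.equalizer φ ψ :=
    h.subalgebra_eq_top (AlgHom.equalizer φ ψ) hφ ▸ Algebra.mem_top
  exact hx

/-- The torus action on `A` by algebra endomorphisms. -/
noncomputable def torus (s r : kˣ) : A →ₐ[k] A :=
  h.lift (fun g => (weight s r g : k) • e g)
    (h.isMatrixTuple.scale (weight s r) (by simp [weight]) (by simp [weight]))

theorem torus_entry (s r : kˣ) (g : Gen) :
    h.torus s r (e g) = (weight s r g : k) • e g := by
  simp [torus]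

theorem torus_torus_inv (s r : kˣ) (x : A) : h.torus s r (h.torus s⁻¹ r⁻¹ x) = x := by
  have : (h.torus s r).comp (h.torus s⁻¹ r⁻¹) = AlgHom.id k _ := by
    apply h.hom_ext
    intro g
    cases g <;> simp [torus_entry, weight, smul_smul]
  exact DFunLike.congr_fun this x

/-- The element `b` is normal. -/
theorem b_mul (x : A) : e .b * x = h.torus q 1 x * e .b := by
  have h' := h.isMatrixTuple
  induction x using h.induction with
  | scalar r => rw [AlgHom.commutes, Algebra.commutes]
  | entry g =>
    cases g
    · simp [torus_entry, weight, h'.ba]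
    · simp [torus_entry, weight]
    · simp [torus_entry, weight, h'.bc]
    · simp [torus_entry, weight, h'.db]
  | mul x y hx hy => rw [← mul_assoc, hx, mul_assoc, hy, map_mul, mul_assoc]
  | add x y hx hy => rw [mul_add, hx, hy, map_add, add_mul]

end IsUniversalTuple

end Presentation

/-! ### Identities between the Koszul generators in the enveloping algebra. -/

section Identities

set_option linter.unusedSimpArgs false

variable {k : Type u} [Field k]

/-- A tuple `x` satisfying the relations, and a tuple `y` satisfying the opposite relations,
which commute with each other. -/
structure IsBimoduleTuple {E : Type v} [Ring E] [Algebra k E] (p q : kˣ) (x y : Gen → E) :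
    Prop where
  left : IsMatrixTuple p q x
  right : IsMatrixTuple p q (fun g => MulOpposite.op (y g))
  comm : ∀ g h, y g * x h = x h * y g

namespace IsBimoduleTuple

variable {E : Type v} [Ring E] [Algebra k E] {p q : kˣ} {x y : Gen → E}
  (h : IsBimoduleTuple p q x y)

/-- Rewriting rules for products of generators. -/
theorem rewriting (h : IsBimoduleTuple p q x y) :
    (x .b * x .a = (q : k) • (x .a * x .b) ∧ x .c * x .a = (p : k) • (x .a * x .c) ∧
      x .d * x .b = (q : k) • (x .b * x .d) ∧ x .d * x .c = (p : k) • (x .c * x .d) ∧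
      x .c * x .b = x .b * x .c ∧ x .a * x .d = 1 + (p⁻¹ : k) • (x .b * x .c) ∧
      x .d * x .a = 1 + (q : k) • (x .b * x .c)) ∧
    (y .a * y .b = (q : k) • (y .b * y .a) ∧ y .a * y .c = (p : k) • (y .c * y .a) ∧
      y .b * y .d = (q : k) • (y .d * y .b) ∧ y .c * y .d = (p : k) • (y .d * y .c) ∧
      y .c * y .b = y .b * y .c ∧ y .d * y .a = 1 + (p⁻¹ : k) • (y .b * y .c) ∧
      y .a * y .d = 1 + (q : k) • (y .b * y .c)) := by
  obtain ⟨h1, h2, h3, h4, h5, h6, h7⟩ := h.right.of_op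
  rw [h5] at h6 h7
  exact ⟨⟨h.left.ba, h.left.ca, h.left.db, h.left.dc, h.left.bc.symm, h.left.ad, h.left.da⟩,
    h1, h2, h3, h4, h5, h6, h7⟩

/-- Rewriting rules for products of generators, in associated form. -/
theorem rewriting_assoc (h : IsBimoduleTuple p q x y) (w : E) :
    (x .b * (x .a * w) = (q : k) • (x .a * (x .b * w)) ∧
      x .c * (x .a * w) = (p : k) • (x .a * (x .c * w)) ∧
      x .d * (x .b * w) = (q : k) • (x .b * (x .d * w)) ∧
      x .d * (x .c * w) = (p : k) • (x .c * (x .d * w)) ∧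
      x .c * (x .b * w) = x .b * (x .c * w) ∧
      x .a * (x .d * w) = w + (p⁻¹ : k) • (x .b * (x .c * w)) ∧
      x .d * (x .a * w) = w + (q : k) • (x .b * (x .c * w))) ∧
    (y .a * (y .b * w) = (q : k) • (y .b * (y .a * w)) ∧
      y .a * (y .c * w) = (p : k) • (y .c * (y .a * w)) ∧
      y .b * (y .d * w) = (q : k) • (y .d * (y .b * w)) ∧
      y .c * (y .d * w) = (p : k) • (y .d * (y .c * w)) ∧
      y .c * (y .b * w) = y .b * (y .c * w) ∧
      y .d * (y .a * w) = w + (p⁻¹ : k) • (y .b * (y .c * w)) ∧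
      y .a * (y .d * w) = w + (q : k) • (y .b * (y .c * w))) ∧
    ∀ i j, y i * (x j * w) = x j * (y i * w) := by
  obtain ⟨⟨h1, h2, h3, h4, h5, h6, h7⟩, g1, g2, g3, g4, g5, g6, g7⟩ := h.rewriting
  refine ⟨⟨?_, ?_, ?_, ?_, ?_, ?_, ?_⟩, ⟨?_, ?_, ?_, ?_, ?_, ?_, ?_⟩, fun i j => ?_⟩ <;>
    rw [← mul_assoc] <;>
    simp only [h1, h2, h3, h4, h5, h6, h7, g1, g2, g3, g4, g5, g6, g7, h.comm, smul_mul_assoc,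
      add_mul, one_mul, mul_assoc]

variable (p q x y) in
/-- The element cutting out the diagonal. -/
def minor : E := x .c * y .d - (p⁻¹ : k) • (x .d * y .c)

/-- This and the next two identities express twisted commutation of the three generators and give
the rows of the second differential. The three `_top` identities below are the relations between
those rows and give the third. -/
theorem beta_alpha (h : IsBimoduleTuple p q x y) :
    (x .b - (q : k) • y .b) * (x .a - y .a) = ((q : k) • x .a - y .a) * (x .b - y .b) := by
  simp only [mul_sub, sub_mul, smul_sub, smul_mul_assoc, mul_smul_comm, mul_assoc, smul_smul,
    h.comm, h.rewriting]
  match_scalars <;> field_simp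

theorem beta_minor (h : IsBimoduleTuple p q x y) :
    ((q : k) • x .b - y .b) * minor p x y =
      ((q : k) • (x .c * y .d) - (p⁻¹ : k) • (x .d * y .c)) * (x .b - y .b) := by
  simp only [minor, mul_sub, sub_mul, smul_sub, smul_mul_assoc, mul_smul_comm, mul_assoc,
    smul_smul, h.comm, h.rewriting, h.rewriting_assoc]
  match_scalars <;> field_simp

theorem alpha_minor (h : IsBimoduleTuple p q x y) :
    ((p : k) • x .a - y .a) * minor p x y =
      (x .c * y .d - x .d * y .c) * (x .a - y .a) +
        ((q - p⁻¹ : k) • (x .c * y .c)) * (x .b - y .b) := by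
  simp only [minor, mul_sub, sub_mul, smul_sub, smul_mul_assoc, mul_smul_comm, mul_assoc,
    smul_smul, h.comm, h.rewriting, h.rewriting_assoc, mul_add, mul_one, smul_add]
  match_scalars <;> field_simp <;> ring

theorem alpha_beta_top (h : IsBimoduleTuple p q x y) :
    ((p * q : k) • x .a - y .a) * ((q : k) • x .b - y .b) =
      ((q : k) • (x .b - y .b)) * ((p : k) • x .a - y .a) := by
  simp only [minor, mul_sub, sub_mul, smul_sub, smul_mul_assoc, mul_smul_comm, mul_assoc,
    smul_smul, h.comm, h.rewriting, h.rewriting_assoc, mul_add, mul_one, smul_add]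
  match_scalars <;> field_simp

theorem minor_beta_top (h : IsBimoduleTuple p q x y) :
    ((q : k) • (x .c * y .d) - x .d * y .c) * (x .b - (q : k) • y .b) =
      ((q : k) • (x .b - y .b)) * (x .c * y .d - x .d * y .c) := by
  simp only [minor, mul_sub, sub_mul, smul_sub, smul_mul_assoc, mul_smul_comm, mul_assoc,
    smul_smul, h.comm, h.rewriting, h.rewriting_assoc, mul_add, mul_one, smul_add]
  match_scalars <;> field_simp

theorem alpha_minor_top (h : IsBimoduleTuple p q x y) :
    ((p * q : k) • x .a - y .a) * ((q : k) • (x .c * y .d) - (p⁻¹ : k) • (x .d * y .c)) =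
      ((q : k) • (x .c * y .d) - x .d * y .c) * ((q : k) • x .a - y .a) +
        ((q : k) • (x .b - y .b)) * ((q - p⁻¹ : k) • (x .c * y .c)) := by
  simp only [minor, mul_sub, sub_mul, smul_sub, smul_mul_assoc, mul_smul_comm, mul_assoc,
    smul_smul, h.comm, h.rewriting, h.rewriting_assoc, mul_add, mul_one, smul_add]
  match_scalars <;> field_simp <;> ring

/-- Modulo the left ideal of `a - a'` and `b - b'`, this reads `c' = c - p a t` with `t` the minor:
the second row moves along a line in the direction of the first row. The companion for `d'` reads
`d' = d - q b t`. -/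
theorem right_c_eq (h : IsBimoduleTuple p q x y) :
    y .c = x .c - (p : k) • (x .a * minor p x y) + x .c * y .d * (x .a - y .a) -
      ((p⁻¹ : k) • (x .c * y .c)) * (x .b - y .b) := by
  simp only [minor, mul_sub, sub_mul, smul_sub, smul_mul_assoc, mul_smul_comm, mul_assoc,
    smul_smul, h.comm, h.rewriting, h.rewriting_assoc, mul_add, mul_one, smul_add]
  match_scalars <;> field_simp <;> ring

theorem right_d_eq (h : IsBimoduleTuple p q x y) :
    y .d = x .d - (q : k) • (x .b * minor p x y) + x .d * y .d * (x .a - y .a) -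
      ((p⁻¹ : k) • (x .d * y .c)) * (x .b - y .b) := by
  simp only [minor, mul_sub, sub_mul, smul_sub, smul_mul_assoc, mul_smul_comm, mul_assoc,
    smul_smul, h.comm, h.rewriting, h.rewriting_assoc, mul_add, mul_one, smul_add]
  match_scalars <;> field_simp <;> ring

theorem right_a_mul (h : IsBimoduleTuple p q x y) (r : k) :
    y .a * (x .b - r • y .b) = (x .b - (r * q) • y .b) * y .a := by
  simp only [mul_sub, sub_mul, smul_mul_assoc, mul_smul_comm, smul_smul, h.comm, h.rewriting]

end IsBimoduleTuple

end Identities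

/-! ### A normal form model, and the regularity of `a` and `b`. -/

section Regularity

open Polynomial

variable {k : Type u} [Field k]

/-- The polynomial algebra in two variables, as iterated polynomials. -/
def Bivariate (k : Type u) [Field k] : Type u := k[X][X]

namespace Bivariate

noncomputable instance : CommRing (Bivariate k) := inferInstanceAs (CommRing k[X][X])

instance : IsDomain (Bivariate k) := inferInstanceAs (IsDomain k[X][X])

noncomputable instance : Algebra k (Bivariate k) := inferInstanceAs (Algebra k k[X][X])

variable (k) in
/-- The first variable. -/
noncomputable def X₁ : Bivariate k := (C X : k[X][X])

variable (k) in
/-- The second variable. -/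
noncomputable def X₂ : Bivariate k := (X : k[X][X])

theorem X₁_ne_zero : X₁ k ≠ 0 := C_ne_zero.2 X_ne_zero

/-- A subalgebra containing both variables is everything. -/
theorem subalgebra_eq_top {S : Subalgebra k (Bivariate k)} (hX : X₁ k ∈ S) (hY : X₂ k ∈ S) :
    S = ⊤ := by
  rw [eq_top_iff]
  rintro (f : k[X][X]) -
  have hC : ∀ g : k[X], (C g : k[X][X]) ∈ S := fun g => by
    induction g using Polynomial.induction_on' with
    | add g₁ g₂ h₁ h₂ => rw [C_add]; exact S.add_mem h₁ h₂
    | monomial n r =>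
      rw [← C_mul_X_pow_eq_monomial, C_mul, C_pow]
      exact S.mul_mem (S.algebraMap_mem r) (S.pow_mem hX n)
  induction f using Polynomial.induction_on' with
  | add g₁ g₂ h₁ h₂ => exact S.add_mem h₁ h₂
  | monomial n r =>
    rw [← C_mul_X_pow_eq_monomial]
    exact S.mul_mem (hC r) (S.pow_mem hY n)

/-- Evaluation of bivariate polynomials at two commuting elements. -/
noncomputable def eval {A : Type v} [Ring A] [Algebra k A] (b c : A) (h : b * c = c * b) :
    Bivariate k →ₐ[k] A :=
  eval₂AlgHom (R := k) (A := k[X]) (aeval b) c fun g => by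
    induction g using Polynomial.induction_on' with
    | add g₁ g₂ h₁ h₂ => rw [map_add]; exact h₁.add_left h₂
    | monomial n r =>
      rw [← C_mul_X_pow_eq_monomial, map_mul, map_pow, aeval_C, aeval_X]
      exact (Algebra.commute_algebraMap_left r c).mul_left (Commute.pow_left h n)

@[simp]
theorem eval_X₁ {A : Type v} [Ring A] [Algebra k A] (b c : A) (h : b * c = c * b) :
    eval b c h (X₁ k) = b :=
  (eval₂_C _ _).trans (aeval_X b)

@[simp]
theorem eval_X₂ {A : Type v} [Ring A] [Algebra k A] (b c : A) (h : b * c = c * b) :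
    eval b c h (X₂ k) = c :=
  eval₂_X _ _

/-- Rescaling of the two variables. -/
noncomputable def rescale (s r : k) : Bivariate k →ₐ[k] Bivariate k :=
  eval (s • X₁ k) (r • X₂ k) (mul_comm _ _)

@[simp]
theorem rescale_X₁ (s r : k) : rescale s r (X₁ k) = s • X₁ k := by simp [rescale]

@[simp]
theorem rescale_X₂ (s r : k) : rescale s r (X₂ k) = r • X₂ k := by simp [rescale]

theorem rescale_rescale_inv (s r : kˣ) (f : Bivariate k) :
    rescale (s : k) (r : k) (rescale (s⁻¹ : k) (r⁻¹ : k) f) = f := by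
  have h : AlgHom.equalizer ((rescale (s : k) (r : k)).comp (rescale (s⁻¹ : k) (r⁻¹ : k)))
      (AlgHom.id k _) = ⊤ := by
    apply Bivariate.subalgebra_eq_top <;> simp [AlgHom.mem_equalizer]
  have hf : f ∈ AlgHom.equalizer ((rescale (s : k) (r : k)).comp (rescale (s⁻¹ : k) (r⁻¹ : k)))
      (AlgHom.id k _) := h ▸ Algebra.mem_top
  exact hf

theorem rescale_inv_rescale (s r : kˣ) (f : Bivariate k) :
    rescale (s⁻¹ : k) (r⁻¹ : k) (rescale (s : k) (r : k) f) = f := by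
  simpa using rescale_rescale_inv s⁻¹ r⁻¹ f

/-- The polynomial `1 + r X₁ X₂`. -/
noncomputable def oneAddXY (r : k) : Bivariate k := 1 + r • (X₁ k * X₂ k)

theorem oneAddXY_ne_zero (r : k) : oneAddXY r ≠ 0 := by
  intro h
  have := congrArg (eval (0 : k) 0 rfl) h
  simp [oneAddXY] at this

theorem rescale_oneAddXY (s r t : k) : rescale s r (oneAddXY t) = oneAddXY (s * r * t) := by
  simp only [oneAddXY, map_add, map_one, map_smul, map_mul, rescale_X₁, rescale_X₂,
    smul_mul_smul_comm, smul_smul]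
  rw [mul_comm]

end Bivariate

/-- The operator on `ℤ`-indexed families shifting the index by `m`, applying `φ` and multiplying
by a weight. -/
noncomputable def weightedShift {R : Type v} [CommRing R] [Algebra k R] (m : ℤ) (φ : R →ₐ[k] R)
    (w : ℤ → R) : Module.End k (ℤ →₀ R) :=
  Finsupp.lsum k fun n => Finsupp.lsingle (n + m) ∘ₗ LinearMap.mulLeft k (w n) ∘ₗ φ.toLinearMap

@[simp]
theorem weightedShift_single {R : Type v} [CommRing R] [Algebra k R] (m : ℤ) (φ : R →ₐ[k] R)
    (w : ℤ → R) (n : ℤ) (f : R) :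
    weightedShift m φ w (Finsupp.single n f) = Finsupp.single (n + m) (w n * φ f) := by
  simp [weightedShift]

theorem weightedShift_apply {R : Type v} [CommRing R] [Algebra k R] (m : ℤ) (φ : R →ₐ[k] R)
    (w : ℤ → R) (v : ℤ →₀ R) (n : ℤ) : weightedShift m φ w v (n + m) = w n * φ (v n) := by
  classical
  induction v using Finsupp.induction_linear with
  | zero => simp
  | add v₁ v₂ h₁ h₂ => simp [h₁, h₂, mul_add]
  | single i f =>
    rw [weightedShift_single, Finsupp.single_apply, Finsupp.single_apply]
    by_cases hi : i = n
    · subst hi; simp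
    · simp [hi]

/-- The shift does not mix indices, so it is enough that each component `f ↦ w n * φ f` is
injective, which holds in a domain. -/
theorem weightedShift_injective {R : Type v} [CommRing R] [IsDomain R] [Algebra k R] (m : ℤ)
    (φ : R →ₐ[k] R) (hφ : Function.Injective φ) (w : ℤ → R) (hw : ∀ n, w n ≠ 0) :
    Function.Injective (weightedShift m φ w) := by
  rw [injective_iff_map_eq_zero]
  intro v hv
  ext1 n
  have h := weightedShift_apply m φ w v n
  rw [hv, Finsupp.zero_apply, eq_comm, mul_eq_zero, or_iff_right (hw n)] at h
  exact hφ (by rw [h, Finsupp.zero_apply, map_zero])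

open Bivariate

/-- The generators acting on the normal form model, in which `single n f` stands for
`f(b, c) aⁿ` if `0 ≤ n`, and for `f(b, c) d⁻ⁿ` if `n ≤ 0`. -/
noncomputable def normalFormOperator (p q : kˣ) : Gen → Module.End k (ℤ →₀ Bivariate k)
  | .a => weightedShift 1 (rescale (q⁻¹ : k) (p⁻¹ : k))
      fun n => if 0 ≤ n then 1 else oneAddXY (p⁻¹ : k)
  | .b => weightedShift 0 (AlgHom.id k _) fun _ => X₁ k
  | .c => weightedShift 0 (AlgHom.id k _) fun _ => X₂ k
  | .d => weightedShift (-1) (rescale (q : k) (p : k))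
      fun n => if n ≤ 0 then 1 else oneAddXY (q : k)

theorem isMatrixTuple_normalFormOperator (p q : kˣ) :
    IsMatrixTuple p q (normalFormOperator p q) where
  ba := by
    refine Finsupp.lhom_ext fun n f => ?_
    simp only [normalFormOperator, Module.End.mul_apply, LinearMap.smul_apply, weightedShift_single,
      map_mul, rescale_X₁, AlgHom.id_apply, Finsupp.smul_single, add_zero]
    congr 1
    simp only [smul_mul_assoc, mul_smul_comm, smul_smul, mul_inv_cancel₀ q.ne_zero, one_smul]
    ring
  ca := by
    refine Finsupp.lhom_ext fun n f => ?_
    simp only [normalFormOperator, Module.End.mul_apply, LinearMap.smul_apply, weightedShift_single,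
      map_mul, rescale_X₂, AlgHom.id_apply, Finsupp.smul_single, add_zero]
    congr 1
    simp only [smul_mul_assoc, mul_smul_comm, smul_smul, mul_inv_cancel₀ p.ne_zero, one_smul]
    ring
  db := by
    refine Finsupp.lhom_ext fun n f => ?_
    simp only [normalFormOperator, Module.End.mul_apply, LinearMap.smul_apply, weightedShift_single,
      map_mul, rescale_X₁, AlgHom.id_apply, Finsupp.smul_single, add_zero]
    congr 1
    simp only [smul_mul_assoc, mul_smul_comm]
    congr 1
    ring
  dc := by
    refine Finsupp.lhom_ext fun n f => ?_
    simp only [normalFormOperator, Module.End.mul_apply, LinearMap.smul_apply, weightedShift_single,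
      map_mul, rescale_X₂, AlgHom.id_apply, Finsupp.smul_single, add_zero]
    congr 1
    simp only [smul_mul_assoc, mul_smul_comm]
    congr 1
    ring
  bc := by
    refine Finsupp.lhom_ext fun n f => ?_
    simp only [normalFormOperator, Module.End.mul_apply, weightedShift_single, AlgHom.id_apply,
      add_zero]
    congr 1
    ring
  ad := by
    refine Finsupp.lhom_ext fun n f => ?_
    simp only [normalFormOperator, Module.End.mul_apply, LinearMap.smul_apply, weightedShift_single,
      map_mul, AlgHom.id_apply, Finsupp.smul_single, add_zero, LinearMap.add_apply,
      Module.End.one_apply, rescale_inv_rescale, neg_add_cancel_right, ← Finsupp.single_add]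
    congr 1
    -- Passing down and up across `n` meets exactly one nontrivial weight. If it comes from `d`,
    -- rescaling turns its parameter `q` into `q⁻¹ p⁻¹ q = p⁻¹`, so both cases agree.
    have : (if 0 ≤ n + -1 then 1 else oneAddXY (p⁻¹ : k)) *
        rescale (q⁻¹ : k) (p⁻¹ : k) (if n ≤ 0 then 1 else oneAddXY (q : k)) =
        oneAddXY (p⁻¹ : k) := by
      by_cases hn : n ≤ 0
      · rw [if_neg (by omega), if_pos hn, map_one, mul_one]
      · rw [if_pos (by omega), if_neg hn, rescale_oneAddXY, one_mul]
        congr 1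
        field_simp
    rw [← mul_assoc, this, oneAddXY, add_mul, one_mul, smul_mul_assoc, mul_assoc]
  da := by
    refine Finsupp.lhom_ext fun n f => ?_
    simp only [normalFormOperator, Module.End.mul_apply, LinearMap.smul_apply, weightedShift_single,
      map_mul, AlgHom.id_apply, Finsupp.smul_single, add_zero, LinearMap.add_apply,
      Module.End.one_apply, rescale_rescale_inv, add_neg_cancel_right, ← Finsupp.single_add]
    congr 1
    have : (if n + 1 ≤ 0 then 1 else oneAddXY (q : k)) *
        rescale (q : k) (p : k) (if 0 ≤ n then 1 else oneAddXY (p⁻¹ : k)) =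
        oneAddXY (q : k) := by
      by_cases hn : 0 ≤ n
      · rw [if_neg (by omega), if_pos hn, map_one, mul_one]
      · rw [if_pos (by omega), if_neg hn, rescale_oneAddXY, one_mul]
        congr 1
        field_simp
    rw [← mul_assoc, this, oneAddXY, add_mul, one_mul, smul_mul_assoc, mul_assoc]

namespace IsMatrixTuple

variable {A : Type v} [Ring A] [Algebra k A] {p q : kˣ} {e : Gen → A}

/-- The powers of `a` and `d`, indexed by `ℤ`. -/
def diagonalPow (e : Gen → A) (n : ℤ) : A := e .a ^ n.toNat * e .d ^ (-n).toNat

theorem a_mul_eval (h : IsMatrixTuple p q e) (f : Bivariate k) :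
    e .a * Bivariate.eval (e .b) (e .c) h.bc f =
      Bivariate.eval (e .b) (e .c) h.bc (rescale (q⁻¹ : k) (p⁻¹ : k) f) * e .a := by
  let S : Subalgebra k (Bivariate k) :=
    { carrier := {f | e .a * Bivariate.eval (e .b) (e .c) h.bc f =
        Bivariate.eval (e .b) (e .c) h.bc (rescale (q⁻¹ : k) (p⁻¹ : k) f) * e .a}
      mul_mem' := fun {f g} hf hg => by
        simp only [Set.mem_ofPred_eq, map_mul] at *
        rw [← mul_assoc, hf, mul_assoc, hg, mul_assoc]
      add_mem' := fun {f g} hf hg => by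
        simp only [Set.mem_ofPred_eq, map_add, mul_add, add_mul] at *
        rw [hf, hg]
      algebraMap_mem' := fun r => by
        simp only [Set.mem_ofPred_eq, AlgHom.commutes]
        exact (Algebra.commutes r (e .a)).symm }
  have hS : S = ⊤ := by
    apply Bivariate.subalgebra_eq_top
    · change e .a * Bivariate.eval (e .b) (e .c) h.bc (X₁ k) =
        Bivariate.eval (e .b) (e .c) h.bc (rescale (q⁻¹ : k) (p⁻¹ : k) (X₁ k)) * e .a
      simp [h.ba]
    · change e .a * Bivariate.eval (e .b) (e .c) h.bc (X₂ k) =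
        Bivariate.eval (e .b) (e .c) h.bc (rescale (q⁻¹ : k) (p⁻¹ : k) (X₂ k)) * e .a
      simp [h.ca]
  have hf : f ∈ S := hS ▸ Algebra.mem_top
  exact hf

theorem d_mul_eval (h : IsMatrixTuple p q e) (f : Bivariate k) :
    e .d * Bivariate.eval (e .b) (e .c) h.bc f =
      Bivariate.eval (e .b) (e .c) h.bc (rescale (q : k) (p : k) f) * e .d := by
  let S : Subalgebra k (Bivariate k) :=
    { carrier := {f | e .d * Bivariate.eval (e .b) (e .c) h.bc f =
        Bivariate.eval (e .b) (e .c) h.bc (rescale (q : k) (p : k) f) * e .d}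
      mul_mem' := fun {f g} hf hg => by
        simp only [Set.mem_ofPred_eq, map_mul] at *
        rw [← mul_assoc, hf, mul_assoc, hg, mul_assoc]
      add_mem' := fun {f g} hf hg => by
        simp only [Set.mem_ofPred_eq, map_add, mul_add, add_mul] at *
        rw [hf, hg]
      algebraMap_mem' := fun r => by
        simp only [Set.mem_ofPred_eq, AlgHom.commutes]
        exact (Algebra.commutes r (e .d)).symm }
  have hS : S = ⊤ := by
    apply Bivariate.subalgebra_eq_top
    · change e .d * Bivariate.eval (e .b) (e .c) h.bc (X₁ k) =
        Bivariate.eval (e .b) (e .c) h.bc (rescale (q : k) (p : k) (X₁ k)) * e .d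
      simp [h.db]
    · change e .d * Bivariate.eval (e .b) (e .c) h.bc (X₂ k) =
        Bivariate.eval (e .b) (e .c) h.bc (rescale (q : k) (p : k) (X₂ k)) * e .d
      simp [h.dc]
  have hf : f ∈ S := hS ▸ Algebra.mem_top
  exact hf

theorem eval_oneAddXY (h : IsMatrixTuple p q e) (r : k) :
    Bivariate.eval (e .b) (e .c) h.bc (oneAddXY r) = 1 + r • (e .b * e .c) := by
  simp [oneAddXY]

/-- For negative `n` the factor `a` cancels one `d` through `ad = 1 + p⁻¹ bc`; this is the origin of
the weights in `normalFormOperator`. -/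
theorem a_mul_diagonalPow (h : IsMatrixTuple p q e) (n : ℤ) :
    e .a * diagonalPow e n = Bivariate.eval (e .b) (e .c) h.bc
      (if 0 ≤ n then 1 else oneAddXY (p⁻¹ : k)) * diagonalPow e (n + 1) := by
  by_cases hn : 0 ≤ n
  · rw [if_pos hn, map_one, one_mul, diagonalPow, diagonalPow, ← mul_assoc, ← pow_succ',
      show (n + 1).toNat = n.toNat + 1 by omega, show (-n).toNat = 0 by omega,
      show (-(n + 1)).toNat = 0 by omega]
  · rw [if_neg hn, h.eval_oneAddXY, diagonalPow, diagonalPow,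
      show (-n).toNat = (-(n + 1)).toNat + 1 by omega, show (n + 1).toNat = 0 by omega,
      show n.toNat = 0 by omega, pow_zero, one_mul, one_mul, pow_succ', ← mul_assoc, h.ad]

theorem d_mul_diagonalPow (h : IsMatrixTuple p q e) (n : ℤ) :
    e .d * diagonalPow e n = Bivariate.eval (e .b) (e .c) h.bc
      (if n ≤ 0 then 1 else oneAddXY (q : k)) * diagonalPow e (n + -1) := by
  by_cases hn : n ≤ 0
  · rw [if_pos hn, map_one, one_mul, diagonalPow, diagonalPow, show n.toNat = 0 by omega,
      show (n + -1).toNat = 0 by omega, pow_zero, one_mul, one_mul, ← pow_succ',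
      show (-(n + -1)).toNat = (-n).toNat + 1 by omega]
  · rw [if_neg hn, h.eval_oneAddXY, diagonalPow, diagonalPow,
      show n.toNat = (n + -1).toNat + 1 by omega, show (-n).toNat = 0 by omega,
      show (-(n + -1)).toNat = 0 by omega, pow_zero, mul_one, mul_one, pow_succ', ← mul_assoc,
      h.da]

/-- The map from the normal form model to the algebra. -/
noncomputable def ofNormalForm (h : IsMatrixTuple p q e) : (ℤ →₀ Bivariate k) →ₗ[k] A :=
  Finsupp.lsum k fun n => LinearMap.mulRight k (diagonalPow e n) ∘ₗ
    (Bivariate.eval (e .b) (e .c) h.bc).toLinearMap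

theorem ofNormalForm_single (h : IsMatrixTuple p q e) (n : ℤ) (f : Bivariate k) :
    h.ofNormalForm (Finsupp.single n f) =
      Bivariate.eval (e .b) (e .c) h.bc f * diagonalPow e n := by
  simp [ofNormalForm]

theorem ofNormalForm_operator (h : IsMatrixTuple p q e) (g : Gen) (v : ℤ →₀ Bivariate k) :
    h.ofNormalForm (normalFormOperator p q g v) = e g * h.ofNormalForm v := by
  induction v using Finsupp.induction_linear with
  | zero => simp
  | add v₁ v₂ h₁ h₂ => rw [map_add, map_add, h₁, h₂, map_add, mul_add]
  | single n f =>
    cases g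
    · rw [normalFormOperator, weightedShift_single, ofNormalForm_single, ofNormalForm_single,
        ← mul_assoc, h.a_mul_eval, mul_assoc _ (e .a), h.a_mul_diagonalPow, mul_comm _ (rescale _ _ f),
        map_mul, mul_assoc]
    · rw [normalFormOperator, weightedShift_single, ofNormalForm_single, ofNormalForm_single,
        map_mul, eval_X₁, AlgHom.id_apply, add_zero, mul_assoc]
    · rw [normalFormOperator, weightedShift_single, ofNormalForm_single, ofNormalForm_single,
        map_mul, eval_X₂, AlgHom.id_apply, add_zero, mul_assoc]
    · rw [normalFormOperator, weightedShift_single, ofNormalForm_single, ofNormalForm_single,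
        ← mul_assoc, h.d_mul_eval, mul_assoc _ (e .d), h.d_mul_diagonalPow, mul_comm _ (rescale _ _ f),
        map_mul, mul_assoc]

end IsMatrixTuple

theorem normalFormOperator_injective_a (p q : kˣ) :
    Function.Injective (normalFormOperator p q .a) := by
  refine weightedShift_injective _ _ ?_ _ fun n => ?_
  · exact Function.LeftInverse.injective (rescale_rescale_inv q p)
  · split_ifs
    · exact one_ne_zero
    · exact oneAddXY_ne_zero _

theorem normalFormOperator_injective_b (p q : kˣ) :
    Function.Injective (normalFormOperator p q .b) :=
  weightedShift_injective _ _ Function.injective_id _ fun _ => X₁_ne_zero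

namespace IsUniversalTuple

variable {A : Type u} [Ring A] [Algebra k A] {p q : kˣ} {e : Gen → A}
  (h : IsUniversalTuple p q e)

/-- The action of the algebra on the normal form model. -/
noncomputable def normalFormAction : A →ₐ[k] Module.End k (ℤ →₀ Bivariate k) :=
  h.lift _ (isMatrixTuple_normalFormOperator p q)

theorem ofNormalForm_action (x : A) (v : ℤ →₀ Bivariate k) :
    h.isMatrixTuple.ofNormalForm (h.normalFormAction x v) =
      x * h.isMatrixTuple.ofNormalForm v := by
  induction x using h.induction generalizing v with
  | scalar r => rw [AlgHom.commutes, Module.algebraMap_end_apply, map_smul, Algebra.smul_def]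
  | entry g => rw [normalFormAction, lift_entry, IsMatrixTuple.ofNormalForm_operator]
  | mul x y hx hy => rw [map_mul, Module.End.mul_apply, hx, hy, mul_assoc]
  | add x y hx hy => rw [map_add, LinearMap.add_apply, map_add, hx, hy, add_mul]

/-- An element `x` is recovered from its action on the vector standing for `1`, because
`ofNormalForm` is equivariant. Hence injectivity of the operator of `g` passes to left
multiplication by `g`; bijectivity of the model is not needed. -/
theorem mul_left_injective_of_operator (h : IsUniversalTuple p q e) (g : Gen)
    (hg : Function.Injective (normalFormOperator p q g)) (x : A) (hx : e g * x = 0) : x = 0 := by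
  have h1 := congrArg (fun y => h.normalFormAction y (Finsupp.single 0 1)) hx
  simp only [map_mul, map_zero, Module.End.mul_apply, LinearMap.zero_apply] at h1
  rw [normalFormAction, lift_entry, map_eq_zero_iff _ hg, ← normalFormAction] at h1
  have h2 := h.ofNormalForm_action x (Finsupp.single 0 1)
  rw [h1, map_zero, IsMatrixTuple.ofNormalForm_single, map_one] at h2
  simpa [IsMatrixTuple.diagonalPow] using h2.symm

theorem eq_zero_of_a_mul (h : IsUniversalTuple p q e) (x : A) (hx : e .a * x = 0) : x = 0 :=
  h.mul_left_injective_of_operator .a (normalFormOperator_injective_a p q) x hx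

theorem eq_zero_of_mul_b (h : IsUniversalTuple p q e) (x : A) (hx : x * e .b = 0) : x = 0 := by
  -- As `b` is normal, right multiplication by `b` is left multiplication up to a torus
  -- automorphism.
  have h1 : e .b * h.torus q⁻¹ 1 x = 0 := by
    rw [h.b_mul]
    have := h.torus_torus_inv q 1 x
    rw [inv_one] at this
    rw [this, hx]
  have h2 := h.mul_left_injective_of_operator .b (normalFormOperator_injective_b p q) _ h1
  have := h.torus_torus_inv q 1 x
  rw [inv_one, h2, map_zero] at this
  exact this.symm

end IsUniversalTuple

end Regularity

/-! ### Leading terms with respect to a `ℤ`-grading. -/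

section Grading

/-- A graded version of the leading term argument: if right multiplication by the leading term `x`
reflects membership from the homogeneous left ideal `I` to `J`, then so does right multiplication
by `x - y`, where `y` has smaller degree. The grading is given by a coaction `δ`. -/
theorem mem_of_mul_leading_mem {E : Type*} [Ring E] (δ : E →+* AddMonoidAlgebra E ℤ)
    (hδ : ∀ u, ((δ u).coeff.sum fun _ r => r) = u) {I J : Ideal E}
    (hI : ∀ u ∈ I, ∀ n, (δ u).coeff n ∈ I) {x y : E}
    (hx : δ x = AddMonoidAlgebra.single 1 x) (hy : δ y = AddMonoidAlgebra.single 0 y)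
    (hJ : ∀ u ∈ J, u * y ∈ I) (hreg : ∀ u, u * x ∈ I → u ∈ J) {u : E} (hu : u * (x - y) ∈ I) :
    u ∈ J := by
  classical
  by_contra huJ
  have hne : ((δ u).coeff.support.filter fun n => (δ u).coeff n ∉ J).Nonempty := by
    by_contra hempty
    apply huJ
    rw [← hδ u]
    refine Submodule.sum_mem _ fun n hn => ?_
    by_contra hnJ
    exact hempty ⟨n, Finset.mem_filter.2 ⟨hn, hnJ⟩⟩
  obtain ⟨n, hn, hmax⟩ := Finset.exists_max_image _ id hne
  have hn' := (Finset.mem_filter.1 hn).2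
  have htop : (δ u).coeff (n + 1) ∈ J := by
    by_contra h
    have := hmax (n + 1) (Finset.mem_filter.2 ⟨Finsupp.mem_support_iff.2 fun h0 =>
      h (h0 ▸ J.zero_mem), h⟩)
    simp at this
  apply hn'
  apply hreg
  -- In degree `n + 1` the product `u * (x - y)` is `uₙ x - uₙ₊₁ y`. The second term is in `I`
  -- because `uₙ₊₁ ∈ J` by maximality, so `uₙ x ∈ I`.
  have key := hI _ hu (n + 1)
  rw [map_mul, map_sub, hx, hy, mul_sub, AddMonoidAlgebra.coeff_sub, Finsupp.sub_apply,
    AddMonoidAlgebra.coeff_mul_single_apply, AddMonoidAlgebra.coeff_mul_single_apply,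
    neg_zero, add_zero, add_neg_cancel_right] at key
  simpa using I.add_mem key (hJ _ htop)

theorem coeff_mem_span_singleton {E : Type*} [Ring E] (δ : E →+* AddMonoidAlgebra E ℤ) {z : E}
    {m : ℤ} (hz : δ z = AddMonoidAlgebra.single m z) {u : E} (hu : u ∈ Ideal.span {z}) (n : ℤ) :
    (δ u).coeff n ∈ Ideal.span {z} := by
  obtain ⟨w, rfl⟩ := Ideal.mem_span_singleton'.1 hu
  rw [map_mul, hz, AddMonoidAlgebra.coeff_mul_single_apply]
  exact Ideal.mul_mem_left _ _ (Ideal.mem_span_singleton_self z)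

end Grading

/-! ### Gradings of the enveloping algebra, and the regularity of `beta` and `alpha`. -/

section Enveloping

variable {k : Type u} [Field k]

open MulOpposite

/-- Twisting a bimodule tuple by scalars and degrees. -/
theorem IsBimoduleTuple.single {E : Type v} [Ring E] [Algebra k E] {p q : kˣ} {x y : Gen → E}
    (h : IsBimoduleTuple p q x y) (w w' : Gen → ℤ) (had : w .a + w .d = 0) (hbc : w .b + w .c = 0)
    (had' : w' .a + w' .d = 0) (hbc' : w' .b + w' .c = 0) :
    IsBimoduleTuple (E := AddMonoidAlgebra E ℤ) p q (fun g => .single (w g) (x g))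
      (fun g => .single (w' g) (y g)) := by
  obtain ⟨⟨h1, h2, h3, h4, h5, h6, h7⟩, g1, g2, g3, g4, g5, g6, g7⟩ := h.rewriting
  refine ⟨⟨?_, ?_, ?_, ?_, ?_, ?_, ?_⟩, ⟨?_, ?_, ?_, ?_, ?_, ?_, ?_⟩, fun g i => ?_⟩
  · simp only [AddMonoidAlgebra.single_mul_single, h1, AddMonoidAlgebra.smul_single, add_comm]
  · simp only [AddMonoidAlgebra.single_mul_single, h2, AddMonoidAlgebra.smul_single, add_comm]
  · simp only [AddMonoidAlgebra.single_mul_single, h3, AddMonoidAlgebra.smul_single, add_comm]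
  · simp only [AddMonoidAlgebra.single_mul_single, h4, AddMonoidAlgebra.smul_single, add_comm]
  · simp only [AddMonoidAlgebra.single_mul_single, h5, add_comm]
  · simp only [AddMonoidAlgebra.single_mul_single, h6, had, hbc, AddMonoidAlgebra.single_add,
      AddMonoidAlgebra.smul_single, AddMonoidAlgebra.one_def]
  · simp only [AddMonoidAlgebra.single_mul_single, h7, add_comm (w .d), had, hbc,
      AddMonoidAlgebra.single_add, AddMonoidAlgebra.smul_single, AddMonoidAlgebra.one_def]
  · simp only [← op_mul, ← op_smul, AddMonoidAlgebra.single_mul_single, g1,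
      AddMonoidAlgebra.smul_single, add_comm]
  · simp only [← op_mul, ← op_smul, AddMonoidAlgebra.single_mul_single, g2,
      AddMonoidAlgebra.smul_single, add_comm]
  · simp only [← op_mul, ← op_smul, AddMonoidAlgebra.single_mul_single, g3,
      AddMonoidAlgebra.smul_single, add_comm]
  · simp only [← op_mul, ← op_smul, AddMonoidAlgebra.single_mul_single, g4,
      AddMonoidAlgebra.smul_single, add_comm]
  · simp only [← op_mul, AddMonoidAlgebra.single_mul_single, g5, add_comm]
  · simp only [← op_mul, ← op_smul, AddMonoidAlgebra.single_mul_single, g5, g6,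
      add_comm (w' .d), add_comm (w' .c), had', hbc', AddMonoidAlgebra.single_add,
      AddMonoidAlgebra.smul_single, ← op_one, AddMonoidAlgebra.one_def, op_add]
  · simp only [← op_mul, ← op_smul, AddMonoidAlgebra.single_mul_single, g5, g7,
      add_comm (w' .c), had', hbc', AddMonoidAlgebra.single_add,
      AddMonoidAlgebra.smul_single, ← op_one, AddMonoidAlgebra.one_def, op_add]
  · simp only [AddMonoidAlgebra.single_mul_single, h.comm, add_comm]

namespace IsUniversalTuple

variable {A : Type u} [Ring A] [Algebra k A] {p q : kˣ} {e : Gen → A}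
  (h : IsUniversalTuple p q e)

variable (k e) in
/-- The generator `g` in the left factor of the enveloping algebra. -/
def leftEntry (g : Gen) : A ⊗[k] Aᵐᵒᵖ := e g ⊗ₜ 1

variable (k e) in
/-- The generator `g` in the right factor of the enveloping algebra. -/
def rightEntry (g : Gen) : A ⊗[k] Aᵐᵒᵖ := 1 ⊗ₜ op (e g)

theorem isBimoduleTuple (h : IsUniversalTuple p q e) :
    IsBimoduleTuple p q (leftEntry k e) (rightEntry k e) where
  left := h.isMatrixTuple.map (Algebra.TensorProduct.includeLeft : A →ₐ[k] A ⊗[k] Aᵐᵒᵖ)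
  right := h.isMatrixTuple.map (AlgHom.opComm.symm
    (Algebra.TensorProduct.includeRight : Aᵐᵒᵖ →ₐ[k] A ⊗[k] Aᵐᵒᵖ))
  comm i j := by simp [leftEntry, rightEntry]

theorem env_subalgebra_eq_top (h : IsUniversalTuple p q e) {S : Subalgebra k (A ⊗[k] Aᵐᵒᵖ)}
    (hl : ∀ g, leftEntry k e g ∈ S) (hr : ∀ g, rightEntry k e g ∈ S) : S = ⊤ := by
  have h1 : S.comap (Algebra.TensorProduct.includeLeft : A →ₐ[k] A ⊗[k] Aᵐᵒᵖ) = ⊤ :=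
    h.subalgebra_eq_top _ hl
  have h2 : (S.comap (Algebra.TensorProduct.includeRight : Aᵐᵒᵖ →ₐ[k] A ⊗[k] Aᵐᵒᵖ)).unop = ⊤ :=
    h.subalgebra_eq_top _ hr
  rw [eq_top_iff]
  rintro u -
  induction u using TensorProduct.induction_on with
  | zero => exact S.zero_mem
  | add u v hu hv => exact S.add_mem hu hv
  | tmul x y =>
    have hx : x ∈ S.comap (Algebra.TensorProduct.includeLeft : A →ₐ[k] A ⊗[k] Aᵐᵒᵖ) :=
      h1 ▸ Algebra.mem_top
    have hy : unop y ∈ (S.comap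
        (Algebra.TensorProduct.includeRight : Aᵐᵒᵖ →ₐ[k] A ⊗[k] Aᵐᵒᵖ)).unop :=
      h2 ▸ Algebra.mem_top
    have := S.mul_mem (show x ⊗ₜ (1 : Aᵐᵒᵖ) ∈ S from hx) (show (1 : A) ⊗ₜ y ∈ S from hy)
    simpa using this

theorem env_hom_ext (h : IsUniversalTuple p q e) {B : Type*} [Ring B] [Algebra k B]
    {φ ψ : A ⊗[k] Aᵐᵒᵖ →ₐ[k] B} (hl : ∀ g, φ (leftEntry k e g) = ψ (leftEntry k e g))
    (hr : ∀ g, φ (rightEntry k e g) = ψ (rightEntry k e g)) : φ = ψ := by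
  ext1 <;> apply AlgHom.ext <;> intro x
  · have hx : x ⊗ₜ (1 : Aᵐᵒᵖ) ∈ AlgHom.equalizer φ ψ :=
      h.env_subalgebra_eq_top (S := AlgHom.equalizer φ ψ) hl hr ▸ Algebra.mem_top
    exact hx
  · have hx : (1 : A) ⊗ₜ x ∈ AlgHom.equalizer φ ψ :=
      h.env_subalgebra_eq_top (S := AlgHom.equalizer φ ψ) hl hr ▸ Algebra.mem_top
    exact hx

theorem commute_lift {B : Type u} [Ring B] [Algebra k B] {x y : Gen → B}
    (hxy : IsBimoduleTuple p q x y) (s : A) (t : Aᵐᵒᵖ) :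
    Commute (h.lift x hxy.left s) (AlgHom.opComm (h.lift _ hxy.right) t) := by
  change Commute _ (unop (h.lift (fun g => op (y g)) hxy.right (unop t)))
  generalize unop t = t
  induction s using h.induction with
  | scalar r => rw [AlgHom.commutes]; exact Algebra.commute_algebraMap_left _ _
  | mul s s' hs hs' => rw [map_mul]; exact hs.mul_left hs'
  | add s s' hs hs' => rw [map_add]; exact hs.add_left hs'
  | entry i =>
    induction t using h.induction with
    | scalar r => rw [AlgHom.commutes]; exact Algebra.commute_algebraMap_right _ _
    | mul s s' hs hs' => rw [map_mul, unop_mul]; exact hs'.mul_right hs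
    | add s s' hs hs' => rw [map_add, unop_add]; exact hs.add_right hs'
    | entry j => rw [lift_entry, lift_entry, unop_op]; exact (hxy.comm j i).symm

/-- The map out of the enveloping algebra given by a bimodule tuple. -/
noncomputable def envLift {B : Type u} [Ring B] [Algebra k B] {x y : Gen → B}
    (hxy : IsBimoduleTuple p q x y) : A ⊗[k] Aᵐᵒᵖ →ₐ[k] B :=
  Algebra.TensorProduct.lift (h.lift x hxy.left) (AlgHom.opComm (h.lift _ hxy.right))
    (h.commute_lift hxy)

@[simp]
theorem envLift_leftEntry {B : Type u} [Ring B] [Algebra k B] {x y : Gen → B}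
    (hxy : IsBimoduleTuple p q x y) (g : Gen) : h.envLift hxy (leftEntry k e g) = x g := by
  rw [envLift, leftEntry, Algebra.TensorProduct.lift_tmul, map_one, mul_one, lift_entry]

@[simp]
theorem envLift_rightEntry {B : Type u} [Ring B] [Algebra k B] {x y : Gen → B}
    (hxy : IsBimoduleTuple p q x y) (g : Gen) : h.envLift hxy (rightEntry k e g) = y g := by
  simp [envLift, rightEntry, AlgHom.opComm]

/-- Under the weight conditions the relations are homogeneous, so the coaction exists by
universality. Forgetting degrees afterwards is an algebra map fixing the generators, hence the
identity. -/
theorem exists_coaction (h : IsUniversalTuple p q e) (w w' : Gen → ℤ) (had : w .a + w .d = 0)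
    (hbc : w .b + w .c = 0) (had' : w' .a + w' .d = 0) (hbc' : w' .b + w' .c = 0) :
    ∃ δ : A ⊗[k] Aᵐᵒᵖ →ₐ[k] AddMonoidAlgebra (A ⊗[k] Aᵐᵒᵖ) ℤ,
      (∀ g, δ (leftEntry k e g) = .single (w g) (leftEntry k e g)) ∧
      (∀ g, δ (rightEntry k e g) = .single (w' g) (rightEntry k e g)) ∧
      ∀ u, ((δ u).coeff.sum fun _ r => r) = u := by
  have hs := h.isBimoduleTuple.single w w' had hbc had' hbc'
  refine ⟨h.envLift hs, h.envLift_leftEntry hs, h.envLift_rightEntry hs, fun u => ?_⟩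
  let ε : AddMonoidAlgebra (A ⊗[k] Aᵐᵒᵖ) ℤ →ₐ[k] A ⊗[k] Aᵐᵒᵖ :=
    AddMonoidAlgebra.liftNCAlgHom (AlgHom.id k _) 1 fun _ _ => Commute.one_right _
  have hε : ∀ f, ε f = f.coeff.sum fun _ r => r := fun f => by
    change f.coeff.sum (fun _ r => r * 1) = _
    simp only [mul_one]
  rw [← hε]
  have : ε.comp (h.envLift hs) = AlgHom.id k _ := by
    apply h.env_hom_ext <;> intro g <;> rw [AlgHom.comp_apply, hε]
    · rw [envLift_leftEntry]
      exact Finsupp.sum_single_index rfl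
    · rw [envLift_rightEntry]
      exact Finsupp.sum_single_index rfl
  exact DFunLike.congr_fun this u

/-- Right multiplication by `b ⊗ 1` is injective modulo the left ideal of `1 ⊗ a`. -/
theorem mem_span_right_a_of_mul_left_b (h : IsUniversalTuple p q e) (u : A ⊗[k] Aᵐᵒᵖ)
    (hu : u * leftEntry k e .b ∈ Ideal.span {rightEntry k e .a}) :
    u ∈ Ideal.span {rightEntry k e .a} := by
  let L : Aᵐᵒᵖ →ₗ[k] Aᵐᵒᵖ := LinearMap.mulRight k (op (e .a))
  -- The quotient of `E` by the left ideal of `1 ⊗ a` is `A ⊗ Q`, on which `b ⊗ 1` acts through the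
  -- first factor only. Flatness over the field preserves its injectivity.
  let Q := Aᵐᵒᵖ ⧸ LinearMap.range L
  let π : A ⊗[k] Aᵐᵒᵖ →ₗ[k] A ⊗[k] Q := LinearMap.lTensor A (LinearMap.range L).mkQ
  have hex : Function.Exact (LinearMap.lTensor A L) π :=
    lTensor_exact A (LinearMap.exact_map_mkQ_range L) (Submodule.mkQ_surjective _)
  have hL : ∀ w, LinearMap.lTensor A L w = w * rightEntry k e .a := fun w => by
    induction w using TensorProduct.induction_on with
    | zero => simp
    | add w w' hw hw' => rw [map_add, hw, hw', add_mul]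
    | tmul x y => simp [L, rightEntry]
  let R : A →ₗ[k] A := LinearMap.mulRight k (e .b)
  have hR : Function.Injective R := by
    rw [injective_iff_map_eq_zero]
    exact h.eq_zero_of_mul_b
  have hπ : ∀ w, π (w * leftEntry k e .b) = LinearMap.rTensor Q R (π w) := fun w => by
    induction w using TensorProduct.induction_on with
    | zero => simp
    | add w w' hw hw' => rw [add_mul, map_add, hw, hw', map_add, map_add]
    | tmul x y => simp [π, R, leftEntry]
  obtain ⟨w, hw⟩ := Ideal.mem_span_singleton'.1 hu
  have h0 : π (u * leftEntry k e .b) = 0 := (hex _).2 ⟨w, by rw [hL, hw]⟩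
  rw [hπ] at h0
  obtain ⟨v, hv⟩ := (hex u).1 (Module.Flat.rTensor_preserves_injective_linearMap R hR
    (h0.trans (map_zero _).symm))
  exact Ideal.mem_span_singleton'.2 ⟨v, by rw [← hL, hv]⟩

theorem eq_zero_of_mul_left_b (h : IsUniversalTuple p q e) (u : A ⊗[k] Aᵐᵒᵖ)
    (hu : u * leftEntry k e .b = 0) : u = 0 := by
  let R : A →ₗ[k] A := LinearMap.mulRight k (e .b)
  have hR : Function.Injective R := by
    rw [injective_iff_map_eq_zero]
    exact h.eq_zero_of_mul_b
  have hπ : ∀ w : A ⊗[k] Aᵐᵒᵖ, w * leftEntry k e .b = LinearMap.rTensor _ R w := fun w => by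
    induction w using TensorProduct.induction_on with
    | zero => simp
    | add w w' hw hw' => rw [add_mul, hw, hw', map_add]
    | tmul x y => simp [R, leftEntry]
  rw [hπ] at hu
  exact Module.Flat.rTensor_preserves_injective_linearMap R hR (hu.trans (map_zero _).symm)

theorem eq_zero_of_mul_right_a (h : IsUniversalTuple p q e) (u : A ⊗[k] Aᵐᵒᵖ)
    (hu : u * rightEntry k e .a = 0) : u = 0 := by
  let R : Aᵐᵒᵖ →ₗ[k] Aᵐᵒᵖ := LinearMap.mulRight k (op (e .a))
  have hR : Function.Injective R := by
    rw [injective_iff_map_eq_zero]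
    exact fun x hx => unop_injective (h.eq_zero_of_a_mul _ (op_injective hx))
  have hπ : ∀ w : A ⊗[k] Aᵐᵒᵖ, w * rightEntry k e .a = LinearMap.lTensor _ R w := fun w => by
    induction w using TensorProduct.induction_on with
    | zero => simp
    | add w w' hw hw' => rw [add_mul, hw, hw', map_add]
    | tmul x y => simp [R, rightEntry]
  rw [hπ] at hu
  exact Module.Flat.lTensor_preserves_injective_linearMap R hR (hu.trans (map_zero _).symm)

/-- The weights of the grading in which `b` has degree one. -/
def bDegree : Gen → ℤ
  | .a => 0
  | .b => 1
  | .c => -1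
  | .d => 0

/-- The weights of the grading in which `a` has degree one. -/
def aDegree : Gen → ℤ
  | .a => 1
  | .b => 0
  | .c => 0
  | .d => -1

theorem eq_zero_of_mul_beta (h : IsUniversalTuple p q e) (r : k) (u : A ⊗[k] Aᵐᵒᵖ)
    (hu : u * (leftEntry k e .b - r • rightEntry k e .b) = 0) : u = 0 := by
  obtain ⟨δ, hl, hr, hδ⟩ := h.exists_coaction bDegree 0 rfl rfl rfl rfl
  rw [← Ideal.mem_bot] at hu ⊢
  refine mem_of_mul_leading_mem (δ : A ⊗[k] Aᵐᵒᵖ →+* _) hδ (I := ⊥) (J := ⊥) ?_ (hl .b) ?_ ?_ ?_ hu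
  · rintro u hu n
    rw [Ideal.mem_bot] at hu
    simp [hu]
  · rw [RingHom.coe_coe, map_smul, hr, AddMonoidAlgebra.smul_single]; rfl
  · rintro u hu
    rw [Ideal.mem_bot] at hu
    simp [hu]
  · intro u hu
    exact h.eq_zero_of_mul_left_b u hu

/-- In the grading by the left `b` the leading term is `b ⊗ 1`. The lower term `1 ⊗ b` preserves the
ideal since it commutes with `1 ⊗ a` up to a scalar. -/
theorem mem_span_right_a_of_mul_beta (h : IsUniversalTuple p q e) (r : k) (u : A ⊗[k] Aᵐᵒᵖ)
    (hu : u * (leftEntry k e .b - r • rightEntry k e .b) ∈ Ideal.span {rightEntry k e .a}) :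
    u ∈ Ideal.span {rightEntry k e .a} := by
  obtain ⟨δ, hl, hr, hδ⟩ := h.exists_coaction bDegree 0 rfl rfl rfl rfl
  refine mem_of_mul_leading_mem (δ : A ⊗[k] Aᵐᵒᵖ →+* _) hδ ?_ (hl .b) ?_ ?_
    h.mem_span_right_a_of_mul_left_b hu
  · intro u hu n
    exact coeff_mem_span_singleton (δ : A ⊗[k] Aᵐᵒᵖ →+* _) (hr .a) hu n
  · rw [RingHom.coe_coe, map_smul, hr, AddMonoidAlgebra.smul_single]; rfl
  · rintro u hu
    obtain ⟨w, rfl⟩ := Ideal.mem_span_singleton'.1 hu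
    rw [mul_smul_comm, mul_assoc, h.isBimoduleTuple.rewriting.2.1, mul_smul_comm, ← mul_assoc,
      ← smul_mul_assoc, ← smul_mul_assoc]
    exact Ideal.mul_mem_left _ _ (Ideal.mem_span_singleton_self _)

/-- The two elements of a regular sequence are exchanged here: from `u a' = v β` one gets `v = w
a'`. Moving `a'` across `β` multiplies `r` by `q`, and `a'` is then cancelled. -/
theorem mem_span_beta_of_mul_right_a (h : IsUniversalTuple p q e) (r : k) (u : A ⊗[k] Aᵐᵒᵖ)
    (hu : u * rightEntry k e .a ∈ Ideal.span {leftEntry k e .b - r • rightEntry k e .b}) :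
    u ∈ Ideal.span {leftEntry k e .b - (r * q) • rightEntry k e .b} := by
  obtain ⟨v, hv⟩ := Ideal.mem_span_singleton'.1 hu
  have hv' := h.mem_span_right_a_of_mul_beta r v
    (hv ▸ Ideal.mul_mem_left _ _ (Ideal.mem_span_singleton_self _))
  obtain ⟨w, rfl⟩ := Ideal.mem_span_singleton'.1 hv'
  rw [mul_assoc, h.isBimoduleTuple.right_a_mul, ← mul_assoc, ← sub_eq_zero, ← sub_mul] at hv
  exact Ideal.mem_span_singleton'.2 ⟨w, sub_eq_zero.1 (h.eq_zero_of_mul_right_a _ hv)⟩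

/-- `a ⊗ 1 - 1 ⊗ a`, suitably twisted, is regular modulo `b ⊗ 1 - 1 ⊗ b`. -/
theorem mem_span_beta_of_mul_alpha (h : IsUniversalTuple p q e) (r s : k) (u : A ⊗[k] Aᵐᵒᵖ)
    (hu : u * (s • leftEntry k e .a - rightEntry k e .a) ∈
      Ideal.span {leftEntry k e .b - r • rightEntry k e .b}) :
    u ∈ Ideal.span {leftEntry k e .b - (r * q) • rightEntry k e .b} := by
  obtain ⟨δ, hl, hr, hδ⟩ := h.exists_coaction 0 aDegree rfl rfl rfl rfl
  -- The sign is reversed so that `1 ⊗ a`, of degree one in the grading of the right factor, becomes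
  -- the leading term.
  have hu' := hu
  rw [mul_sub, sub_mem_comm_iff, ← mul_sub] at hu'
  refine mem_of_mul_leading_mem (δ : A ⊗[k] Aᵐᵒᵖ →+* _) hδ ?_ (hr .a)
    (y := s • leftEntry k e .a) ?_ ?_ (h.mem_span_beta_of_mul_right_a r)
    hu'
  · intro u hu n
    refine coeff_mem_span_singleton (δ : A ⊗[k] Aᵐᵒᵖ →+* _) (m := 0) ?_ hu n
    rw [RingHom.coe_coe, map_sub, map_smul, hl, hr, AddMonoidAlgebra.smul_single,
      AddMonoidAlgebra.single_sub]
    rfl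
  · rw [RingHom.coe_coe, map_smul, hl, AddMonoidAlgebra.smul_single]; rfl
  · rintro u hu
    obtain ⟨w, rfl⟩ := Ideal.mem_span_singleton'.1 hu
    have : (leftEntry k e .b - (r * q) • rightEntry k e .b) * s • leftEntry k e .a =
        ((s * q) • leftEntry k e .a) * (leftEntry k e .b - r • rightEntry k e .b) := by
      simp only [sub_mul, mul_sub, smul_mul_assoc, mul_smul_comm, smul_smul,
        h.isBimoduleTuple.comm, h.isBimoduleTuple.rewriting]
      match_scalars <;> ring
    rw [mul_assoc, this, ← mul_assoc]
    exact Ideal.mul_mem_left _ _ (Ideal.mem_span_singleton_self _)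

end IsUniversalTuple

end Enveloping

/-! ### The twisted polynomial module, and the regularity of `gamma`. -/

section Affine

variable {k : Type u} [Field k]

open MulOpposite

/-- The torus acts on the right half of a bimodule tuple. -/
theorem IsBimoduleTuple.scaleRight {E : Type v} [Ring E] [Algebra k E] {p q : kˣ} {x y : Gen → E}
    (h : IsBimoduleTuple p q x y) (s r : kˣ) :
    IsBimoduleTuple p q x (fun g => (weight s r g : k) • y g) where
  left := h.left
  right := h.right.scale (weight s r) (by simp [weight]) (by simp [weight])
  comm i j := by rw [smul_mul_assoc, mul_smul_comm, h.comm]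

/-- The operator on sequences shifting the index by `m`, multiplying by `t` on the right and by
a scalar weight. -/
noncomputable def rightShift {A : Type v} [Ring A] [Algebra k A] (m : ℕ) (w : ℕ → k) (t : A) :
    Module.End k (ℕ →₀ A) :=
  Finsupp.lsum k fun n => w n • (Finsupp.lsingle (n + m) ∘ₗ LinearMap.mulRight k t)

@[simp]
theorem rightShift_single {A : Type v} [Ring A] [Algebra k A] (m : ℕ) (w : ℕ → k) (t : A) (n : ℕ)
    (x : A) :
    rightShift m w t (Finsupp.single n x) = w n • Finsupp.single (n + m) (x * t) := by
  simp [rightShift]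

/-- The right action of the generators on sequences, which stand for polynomials
`∑ xₙ tⁿ` in a variable `t` with coefficients on the left; the element `c` is mapped to
`c - p a t`, and `d` to `d - q b t`, up to twists. -/
noncomputable def affineOperator {A : Type v} [Ring A] [Algebra k A] (p q : kˣ) (e : Gen → A) :
    Gen → Module.End k (ℕ →₀ A)
  | .a => rightShift 0 (fun n => (p : k) ^ n) (e .a)
  | .b => rightShift 0 (fun n => (q : k) ^ n) (e .b)
  | .c => rightShift 0 (fun n => (q⁻¹ : k) ^ n) (e .c) -
      (p : k) • rightShift 1 (fun n => (q⁻¹ : k) ^ n) (e .a)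
  | .d => rightShift 0 (fun n => (p⁻¹ : k) ^ n) (e .d) -
      (q : k) • rightShift 1 (fun n => (p⁻¹ : k) ^ n) (e .b)

/-- Adding multiples of the first row to the second preserves the relations, provided `t` moves past
the generators with torus weights `p, q, q⁻¹, p⁻¹`. -/
theorem isBimoduleTuple_affineOperator {A : Type v} [Ring A] [Algebra k A] {p q : kˣ}
    {e : Gen → A} (h : IsMatrixTuple p q e) :
    IsBimoduleTuple p q (fun g => Algebra.lsmul k k (ℕ →₀ A) (e g)) (affineOperator p q e) where
  left := by
    have := h.map (C := Module.End k (ℕ →₀ A)) (Algebra.lsmul k k (ℕ →₀ A))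
    exact this
  right := by
    constructor <;> apply unop_injective <;> refine Finsupp.lhom_ext fun n x => ?_ <;>
    simp only [unop_mul, unop_op, unop_smul, unop_add, unop_one, affineOperator,
      Module.End.mul_apply, LinearMap.sub_apply, LinearMap.add_apply, LinearMap.smul_apply,
      Module.End.one_apply, rightShift_single, map_sub, map_smul, smul_sub, smul_smul, mul_assoc,
      add_zero, h.ba, h.ca, h.db, h.dc, ← h.bc, h.ad, h.da, mul_smul_comm, mul_add, mul_one,
      Finsupp.single_add, ← Finsupp.smul_single, smul_add, inv_pow, pow_succ, add_assoc,
      Nat.reduceAdd] <;>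
    match_scalars <;> field_simp
  comm i j := by
    refine Finsupp.lhom_ext fun n x => ?_
    cases i <;>
    simp only [affineOperator, Module.End.mul_apply, Algebra.lsmul_coe, Finsupp.smul_single,
      smul_eq_mul, rightShift_single, LinearMap.sub_apply, LinearMap.smul_apply, mul_assoc,
      smul_sub, mul_smul_comm]

namespace IsUniversalTuple

variable {A : Type u} [Ring A] [Algebra k A] {p q : kˣ} {e : Gen → A}
  (h : IsUniversalTuple p q e)

/-- Induction on elements of the enveloping algebra. -/
theorem env_induction (h : IsUniversalTuple p q e) {P : A ⊗[k] Aᵐᵒᵖ → Prop}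
    (scalar : ∀ r : k, P (algebraMap k _ r)) (left : ∀ g, P (leftEntry k e g))
    (right : ∀ g, P (rightEntry k e g)) (mul : ∀ x y, P x → P y → P (x * y))
    (add : ∀ x y, P x → P y → P (x + y)) (u : A ⊗[k] Aᵐᵒᵖ) : P u := by
  let S : Subalgebra k (A ⊗[k] Aᵐᵒᵖ) :=
    { carrier := {x | P x}
      mul_mem' := fun {x y} hx hy => mul x y hx hy
      add_mem' := fun {x y} hx hy => add x y hx hy
      algebraMap_mem' := scalar }
  have hS : S = ⊤ := h.env_subalgebra_eq_top left right
  have hx : u ∈ S := hS ▸ Algebra.mem_top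
  exact hx

/-- The torus action on the right factor of the enveloping algebra. -/
noncomputable def rightTorus (s r : kˣ) : A ⊗[k] Aᵐᵒᵖ →ₐ[k] A ⊗[k] Aᵐᵒᵖ :=
  h.envLift (h.isBimoduleTuple.scaleRight s r)

@[simp]
theorem rightTorus_left (s r : kˣ) (g : Gen) :
    h.rightTorus s r (leftEntry k e g) = leftEntry k e g :=
  h.envLift_leftEntry _ g

@[simp]
theorem rightTorus_right (s r : kˣ) (g : Gen) :
    h.rightTorus s r (rightEntry k e g) = (weight s r g : k) • rightEntry k e g :=
  h.envLift_rightEntry _ g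

theorem rightTorus_inv (s r : kˣ) (u : A ⊗[k] Aᵐᵒᵖ) :
    h.rightTorus s⁻¹ r⁻¹ (h.rightTorus s r u) = u := by
  have : (h.rightTorus s⁻¹ r⁻¹).comp (h.rightTorus s r) = AlgHom.id k _ := by
    apply h.env_hom_ext <;> intro g
    · simp
    · cases g <;> simp [weight, smul_smul]
  exact DFunLike.congr_fun this u

/-- The action of the enveloping algebra on sequences. -/
noncomputable def affineAction : A ⊗[k] Aᵐᵒᵖ →ₐ[k] Module.End k (ℕ →₀ A) :=
  h.envLift (isBimoduleTuple_affineOperator h.isMatrixTuple)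

theorem affineAction_left (g : Gen) (n : ℕ) (x : A) :
    h.affineAction (leftEntry k e g) (Finsupp.single n x) = Finsupp.single n (e g * x) := by
  simp [affineAction]

theorem affineAction_right (g : Gen) :
    h.affineAction (rightEntry k e g) = affineOperator p q e g := by
  simp [affineAction]

/-- The shift of sequences. -/
noncomputable def shift (k : Type u) [Field k] (A : Type u) [Ring A] [Algebra k A] :
    Module.End k (ℕ →₀ A) := rightShift 1 (fun _ => 1) 1

theorem shift_single (n : ℕ) (x : A) :
    shift k A (Finsupp.single n x) = Finsupp.single (n + 1) x := by simp [shift]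

theorem shift_injective : Function.Injective (shift k A) := by
  have : shift k A = Finsupp.lmapDomain A k (· + 1) := by
    refine Finsupp.lhom_ext fun n x => ?_
    simp [shift_single]
  rw [this]
  exact Finsupp.mapDomain_injective (add_left_injective 1)

/-- Raising the exponent of `t` by one multiplies the weight of each right generator by a fixed
scalar, which the torus element `(p⁻¹, q⁻¹)` undoes. -/
theorem shift_affineAction (u : A ⊗[k] Aᵐᵒᵖ) (v : ℕ →₀ A) :
    shift k A (h.affineAction u v) = h.affineAction (h.rightTorus p⁻¹ q⁻¹ u) (shift k A v) := by
  induction u using h.env_induction generalizing v with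
  | scalar r => rw [AlgHom.commutes, AlgHom.commutes, AlgHom.commutes,
      Module.algebraMap_end_apply, Module.algebraMap_end_apply, map_smul]
  | left g =>
    rw [rightTorus_left]
    induction v using Finsupp.induction_linear with
    | zero => simp
    | add v w hv hw => simp only [map_add, hv, hw]
    | single n x => simp only [affineAction_left, shift_single]
  | right g =>
    rw [rightTorus_right, map_smul, affineAction_right, LinearMap.smul_apply]
    induction v using Finsupp.induction_linear with
    | zero => simp
    | add v w hv hw => simp only [map_add, hv, hw, smul_add]
    | single n x =>
      cases g <;>
      simp only [affineOperator, weight, shift_single, rightShift_single, map_smul, smul_smul,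
        LinearMap.sub_apply, LinearMap.smul_apply, map_sub, smul_sub, pow_succ, inv_inv, add_zero,
        Units.val_inv_eq_inv_val, inv_pow]
      all_goals
        match_scalars <;> field_simp
  | mul u w hu hw => rw [map_mul, map_mul, map_mul, Module.End.mul_apply, hu, hw,
      Module.End.mul_apply]
  | add u w hu hw => simp only [map_add, LinearMap.add_apply, hu, hw]

variable (k e) in
/-- `a ⊗ 1 - 1 ⊗ a`. -/
def alpha : A ⊗[k] Aᵐᵒᵖ := leftEntry k e .a - rightEntry k e .a

variable (k e) in
/-- `b ⊗ 1 - 1 ⊗ b`. -/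
def beta : A ⊗[k] Aᵐᵒᵖ := leftEntry k e .b - rightEntry k e .b

variable (p e) in
/-- `c ⊗ d - p⁻¹ d ⊗ c`. -/
noncomputable def gamma : A ⊗[k] Aᵐᵒᵖ :=
  IsBimoduleTuple.minor p (leftEntry k e) (rightEntry k e)

theorem affineAction_alpha :
    h.affineAction (alpha k e) (Finsupp.single 0 1) = 0 := by
  rw [alpha, map_sub, LinearMap.sub_apply, affineAction_left, affineAction_right]
  simp [affineOperator]

theorem affineAction_beta :
    h.affineAction (beta k e) (Finsupp.single 0 1) = 0 := by
  rw [beta, map_sub, LinearMap.sub_apply, affineAction_left, affineAction_right]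
  simp [affineOperator]

/-- The constant term is `cd - p⁻¹ dc = 0`, and the coefficient of `t` is the quantum determinant
`da - q bc = 1`. -/
theorem affineAction_gamma :
    h.affineAction (gamma p e) (Finsupp.single 0 1) = Finsupp.single 1 1 := by
  have h' := h.isMatrixTuple
  simp only [gamma, IsBimoduleTuple.minor, map_sub, map_mul, map_smul, LinearMap.sub_apply,
    LinearMap.smul_apply, Module.End.mul_apply, affineAction_right, affineOperator,
    rightShift_single, affineAction_left, pow_zero, one_smul, one_mul, zero_add, h'.dc, h'.da,
    ← h'.bc, smul_sub, Finsupp.single_add, ← Finsupp.smul_single, smul_add, smul_smul]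
  match_scalars <;> field_simp <;> ring

theorem affineAction_eq_zero {u : A ⊗[k] Aᵐᵒᵖ} (hu : u ∈ Ideal.span {alpha k e, beta k e}) :
    h.affineAction u (Finsupp.single 0 1) = 0 := by
  obtain ⟨s, t, rfl⟩ := Submodule.mem_span_pair.1 hu
  rw [smul_eq_mul, smul_eq_mul, map_add, map_mul, map_mul, LinearMap.add_apply,
    Module.End.mul_apply, Module.End.mul_apply, affineAction_alpha, affineAction_beta, map_zero,
    map_zero, add_zero]

theorem rightTorus_alpha : h.rightTorus p⁻¹ q⁻¹ (alpha k e) =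
    (p⁻¹ : k) • ((p : k) • leftEntry k e .a - rightEntry k e .a) := by
  simp [alpha, weight, smul_sub, smul_smul]

theorem rightTorus_beta : h.rightTorus p⁻¹ q⁻¹ (beta k e) =
    (q⁻¹ : k) • ((q : k) • leftEntry k e .b - rightEntry k e .b) := by
  simp [beta, weight, smul_sub, smul_smul]

theorem rightTorus_mem {u : A ⊗[k] Aᵐᵒᵖ} (hu : u ∈ Ideal.span {alpha k e, beta k e}) :
    h.rightTorus p⁻¹ q⁻¹ u ∈ Ideal.span {(p : k) • leftEntry k e .a - rightEntry k e .a,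
      (q : k) • leftEntry k e .b - rightEntry k e .b} := by
  obtain ⟨s, t, rfl⟩ := Submodule.mem_span_pair.1 hu
  rw [smul_eq_mul, smul_eq_mul, map_add, map_mul, map_mul, rightTorus_alpha, rightTorus_beta]
  refine add_mem (Ideal.mul_mem_left _ _ (Submodule.smul_of_tower_mem _ _ ?_))
    (Ideal.mul_mem_left _ _ (Submodule.smul_of_tower_mem _ _ ?_)) <;>
  exact Submodule.subset_span (by simp)

theorem mul_gamma_mem (h : IsUniversalTuple p q e) {u : A ⊗[k] Aᵐᵒᵖ}
    (hu : u ∈ Ideal.span {(p : k) • leftEntry k e .a - rightEntry k e .a,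
      (q : k) • leftEntry k e .b - rightEntry k e .b}) :
    u * gamma p e ∈ Ideal.span {alpha k e, beta k e} := by
  have hα : alpha k e ∈ Ideal.span {alpha k e, beta k e} := Submodule.subset_span (by simp)
  have hβ : beta k e ∈ Ideal.span {alpha k e, beta k e} := Submodule.subset_span (by simp)
  obtain ⟨s, t, rfl⟩ := Submodule.mem_span_pair.1 hu
  rw [smul_eq_mul, smul_eq_mul, add_mul, mul_assoc, mul_assoc, gamma,
    h.isBimoduleTuple.alpha_minor, h.isBimoduleTuple.beta_minor]
  exact add_mem (Ideal.mul_mem_left _ _ (add_mem (Ideal.mul_mem_left _ _ hα)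
    (Ideal.mul_mem_left _ _ hβ))) (Ideal.mul_mem_left _ _ (Ideal.mul_mem_left _ _ hβ))

/-- The element of the enveloping algebra which sends the first basis vector to the `n`-th one. -/
noncomputable def gammaPow : ℕ → A ⊗[k] Aᵐᵒᵖ
  | 0 => 1
  | n + 1 => h.rightTorus p⁻¹ q⁻¹ (gammaPow n) * gamma p e

/-- This is the induction step for the four congruences below: applying `u ↦ τ(u) γ` to the
congruence for `n`, with `τ` the torus twist, gives the one for `n + 1` up to a scalar. -/
theorem mul_gammaPow_succ_mem {u : A ⊗[k] Aᵐᵒᵖ} (hu : u ∈ Ideal.span {alpha k e, beta k e}) :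
    h.rightTorus p⁻¹ q⁻¹ u * gamma p e ∈ Ideal.span {alpha k e, beta k e} :=
  h.mul_gamma_mem (h.rightTorus_mem hu)

theorem right_a_mul_gammaPow (n : ℕ) :
    (p : k) ^ n • (leftEntry k e .a * h.gammaPow n) - rightEntry k e .a * h.gammaPow n ∈
      Ideal.span {alpha k e, beta k e} := by
  induction n with
  | zero => simpa [gammaPow, alpha] using
      Submodule.subset_span (s := {alpha k e, beta k e}) (by simp [alpha])
  | succ n ih =>
    have := Submodule.smul_of_tower_mem _ (p : k) (h.mul_gammaPow_succ_mem ih)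
    simp only [map_sub, map_smul, map_mul, rightTorus_left, rightTorus_right, sub_mul, weight,
      smul_sub, smul_mul_assoc, smul_smul, mul_assoc, Units.val_inv_eq_inv_val,
      mul_inv_cancel₀ p.ne_zero, one_smul] at this
    rw [pow_succ', gammaPow]
    exact this

theorem right_b_mul_gammaPow (n : ℕ) :
    (q : k) ^ n • (leftEntry k e .b * h.gammaPow n) - rightEntry k e .b * h.gammaPow n ∈
      Ideal.span {alpha k e, beta k e} := by
  induction n with
  | zero => simpa [gammaPow, beta] using
      Submodule.subset_span (s := {alpha k e, beta k e}) (by simp [beta])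
  | succ n ih =>
    have := Submodule.smul_of_tower_mem _ (q : k) (h.mul_gammaPow_succ_mem ih)
    simp only [map_sub, map_smul, map_mul, rightTorus_left, rightTorus_right, sub_mul, weight,
      smul_sub, smul_mul_assoc, smul_smul, mul_assoc, Units.val_inv_eq_inv_val,
      mul_inv_cancel₀ q.ne_zero, one_smul] at this
    rw [pow_succ', gammaPow]
    exact this

theorem right_c_mul_gammaPow (n : ℕ) :
    (q⁻¹ : k) ^ n • (leftEntry k e .c * h.gammaPow n -
      (p : k) • (leftEntry k e .a * h.gammaPow (n + 1))) - rightEntry k e .c * h.gammaPow n ∈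
      Ideal.span {alpha k e, beta k e} := by
  induction n with
  | zero =>
    have hc := h.isBimoduleTuple.right_c_eq
    have hα : alpha k e ∈ Ideal.span {alpha k e, beta k e} := Submodule.subset_span (by simp)
    have hβ : beta k e ∈ Ideal.span {alpha k e, beta k e} := Submodule.subset_span (by simp)
    have := sub_mem (Ideal.mul_mem_left _ ((p⁻¹ : k) • (leftEntry k e .c * rightEntry k e .c)) hβ)
      (Ideal.mul_mem_left _ (leftEntry k e .c * rightEntry k e .d) hα)
    convert this using 1
    simp only [gammaPow, map_one, one_mul, mul_one, pow_zero, one_smul]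
    nth_rw 1 [hc]
    rw [gamma, alpha, beta]
    abel
  | succ n ih =>
    have := Submodule.smul_of_tower_mem _ (q⁻¹ : k) (h.mul_gammaPow_succ_mem ih)
    simp only [map_sub, map_smul, map_mul, rightTorus_left, rightTorus_right, sub_mul, weight,
      smul_sub, smul_mul_assoc, smul_smul, mul_assoc, inv_inv,
      inv_mul_cancel₀ q.ne_zero, one_smul] at this
    rw [pow_succ', gammaPow, gammaPow]
    simpa only [smul_sub, smul_smul, mul_assoc] using this

theorem right_d_mul_gammaPow (n : ℕ) :
    (p⁻¹ : k) ^ n • (leftEntry k e .d * h.gammaPow n -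
      (q : k) • (leftEntry k e .b * h.gammaPow (n + 1))) - rightEntry k e .d * h.gammaPow n ∈
      Ideal.span {alpha k e, beta k e} := by
  induction n with
  | zero =>
    have hd := h.isBimoduleTuple.right_d_eq
    have hα : alpha k e ∈ Ideal.span {alpha k e, beta k e} := Submodule.subset_span (by simp)
    have hβ : beta k e ∈ Ideal.span {alpha k e, beta k e} := Submodule.subset_span (by simp)
    have := sub_mem (Ideal.mul_mem_left _ ((p⁻¹ : k) • (leftEntry k e .d * rightEntry k e .c)) hβ)
      (Ideal.mul_mem_left _ (leftEntry k e .d * rightEntry k e .d) hα)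
    convert this using 1
    simp only [gammaPow, map_one, one_mul, mul_one, pow_zero, one_smul]
    nth_rw 1 [hd]
    rw [gamma, alpha, beta]
    abel
  | succ n ih =>
    have := Submodule.smul_of_tower_mem _ (p⁻¹ : k) (h.mul_gammaPow_succ_mem ih)
    simp only [map_sub, map_smul, map_mul, rightTorus_left, rightTorus_right, sub_mul, weight,
      smul_sub, smul_mul_assoc, smul_smul, mul_assoc, inv_inv,
      inv_mul_cancel₀ p.ne_zero, one_smul] at this
    rw [pow_succ', gammaPow, gammaPow]
    simpa only [smul_sub, smul_smul, mul_assoc] using this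

/-- The map sending a sequence `(xₙ)` to `∑ (xₙ ⊗ 1) γₙ`. -/
noncomputable def ofSequence : (ℕ →₀ A) →ₗ[k] A ⊗[k] Aᵐᵒᵖ :=
  Finsupp.lsum k fun n => LinearMap.mulRight k (h.gammaPow n) ∘ₗ
    (Algebra.TensorProduct.includeLeft : A →ₐ[k] A ⊗[k] Aᵐᵒᵖ).toLinearMap

theorem ofSequence_single (n : ℕ) (x : A) :
    h.ofSequence (Finsupp.single n x) = (x ⊗ₜ 1) * h.gammaPow n := by
  simp [ofSequence]

theorem rightEntry_mul_tmul_one (g : Gen) (x : A) :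
    rightEntry k e g * (x ⊗ₜ 1) = (x ⊗ₜ 1) * rightEntry k e g := by
  simp [rightEntry]

theorem mul_tmul_one (g : Gen) (x : A) :
    ((x * e g) ⊗ₜ 1 : A ⊗[k] Aᵐᵒᵖ) = (x ⊗ₜ 1) * leftEntry k e g := by
  simp [leftEntry]

theorem tmul_one_mul (g : Gen) (x : A) :
    ((e g * x) ⊗ₜ 1 : A ⊗[k] Aᵐᵒᵖ) = leftEntry k e g * (x ⊗ₜ 1) := by
  simp [leftEntry]

/-- Equivariance modulo the ideal. It is exact for left generators; for right ones it is the
congruences for `gammaPow`, since `x ⊗ 1` commutes with the right factor. -/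
theorem ofSequence_affineAction (u : A ⊗[k] Aᵐᵒᵖ) (v : ℕ →₀ A) :
    h.ofSequence (h.affineAction u v) - u * h.ofSequence v ∈
      Ideal.span {alpha k e, beta k e} := by
  induction u using h.env_induction generalizing v with
  | scalar r =>
    rw [AlgHom.commutes, Module.algebraMap_end_apply, map_smul,
      Algebra.algebraMap_eq_smul_one, smul_mul_assoc, one_mul, sub_self]
    exact zero_mem _
  | add u w hu hw =>
    simp only [map_add, LinearMap.add_apply, add_mul, add_sub_add_comm]
    exact add_mem (hu v) (hw v)
  | mul u w hu hw =>
    have := add_mem (hu (h.affineAction w v)) (Ideal.mul_mem_left _ u (hw v))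
    rw [mul_sub, sub_add_sub_cancel, ← mul_assoc] at this
    simpa only [map_mul, Module.End.mul_apply] using this
  | left g =>
    induction v using Finsupp.induction_linear with
    | zero => simp
    | add v w hv hw =>
      simp only [map_add, mul_add, add_sub_add_comm]
      exact add_mem hv hw
    | single n x =>
      rw [affineAction_left, ofSequence_single, ofSequence_single, tmul_one_mul, mul_assoc,
        sub_self]
      exact zero_mem _
  | right g =>
    rw [affineAction_right]
    induction v using Finsupp.induction_linear with
    | zero => simp
    | add v w hv hw =>
      simp only [map_add, mul_add, add_sub_add_comm]
      exact add_mem hv hw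
    | single n x =>
      rw [ofSequence_single, ← mul_assoc, rightEntry_mul_tmul_one, mul_assoc]
      cases g
      · convert Ideal.mul_mem_left _ (x ⊗ₜ 1) (h.right_a_mul_gammaPow n) using 1
        simp only [affineOperator, rightShift_single, map_smul, ofSequence_single, mul_tmul_one,
          mul_sub, mul_smul_comm, mul_assoc, add_zero]
      · convert Ideal.mul_mem_left _ (x ⊗ₜ 1) (h.right_b_mul_gammaPow n) using 1
        simp only [affineOperator, rightShift_single, map_smul, ofSequence_single, mul_tmul_one,
          mul_sub, mul_smul_comm, mul_assoc, add_zero]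
      · convert Ideal.mul_mem_left _ (x ⊗ₜ 1) (h.right_c_mul_gammaPow n) using 1
        simp only [affineOperator, rightShift_single, map_smul, ofSequence_single, mul_tmul_one,
          mul_sub, mul_smul_comm, mul_assoc, add_zero, map_sub, LinearMap.sub_apply,
          LinearMap.smul_apply, smul_sub, smul_comm (p : k)]
      · convert Ideal.mul_mem_left _ (x ⊗ₜ 1) (h.right_d_mul_gammaPow n) using 1
        simp only [affineOperator, rightShift_single, map_smul, ofSequence_single, mul_tmul_one,
          mul_sub, mul_smul_comm, mul_assoc, add_zero, map_sub, LinearMap.sub_apply,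
          LinearMap.smul_apply, smul_sub, smul_comm (q : k)]

/-- Since `ofSequence` takes the first basis vector to `1`, it recovers `u` modulo the ideal from
the action of `u` on that vector. With `affineAction_eq_zero`, the ideal is exactly the annihilator.
-/
theorem mem_of_affineAction_eq_zero {u : A ⊗[k] Aᵐᵒᵖ}
    (hu : h.affineAction u (Finsupp.single 0 1) = 0) : u ∈ Ideal.span {alpha k e, beta k e} := by
  have := h.ofSequence_affineAction u (Finsupp.single 0 1)
  rw [hu, map_zero, ofSequence_single, gammaPow, ← Algebra.TensorProduct.one_def, mul_one, mul_one,
    sub_mem_comm_iff, sub_zero] at this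
  exact this

/-- The element `gamma` is regular modulo `alpha` and `beta`. -/
theorem mem_of_mul_gamma (h : IsUniversalTuple p q e) {u : A ⊗[k] Aᵐᵒᵖ}
    (hu : u * gamma p e ∈ Ideal.span {alpha k e, beta k e}) :
    u ∈ Ideal.span {(p : k) • leftEntry k e .a - rightEntry k e .a,
      (q : k) • leftEntry k e .b - rightEntry k e .b} := by
  have h0 := h.affineAction_eq_zero hu
  rw [map_mul, Module.End.mul_apply, affineAction_gamma] at h0
  have h1 := h.rightTorus_inv p q u
  -- Writing `u` as a torus twist lets the shift be pulled outside and cancelled; the twist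
  -- reappears in the generators of the target ideal.
  rw [← h1, ← shift_single (k := k) 0, ← shift_affineAction,
    map_eq_zero_iff _ shift_injective] at h0
  rw [← h1]
  exact h.rightTorus_mem (h.mem_of_affineAction_eq_zero h0)

end IsUniversalTuple

end Affine

/-! ### The twisted Koszul complex and its length. -/

section Resolution

open CategoryTheory

/-- Dimension shifting along a short exact sequence of modules with projective middle term. -/
theorem hasProjectiveDimensionLT_iff_of_exact {R : Type v} [Ring R] {N P M : Type v}
    [AddCommGroup N] [Module R N] [AddCommGroup P] [Module R P] [AddCommGroup M] [Module R M]
    [Module.Projective R P] (f : N →ₗ[R] P) (g : P →ₗ[R] M) (hf : Function.Injective f)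
    (hfg : Function.Exact f g) (hg : Function.Surjective g) (n : ℕ) :
    HasProjectiveDimensionLT (ModuleCat.of R M) (n + 2) ↔
      HasProjectiveDimensionLT (ModuleCat.of R N) (n + 1) := by
  let S : ShortComplex (ModuleCat.{v} R) := ShortComplex.moduleCatMk f g hfg.linearMap_comp_eq_zero
  have hS : S.ShortExact :=
    { exact := (ShortComplex.ShortExact.moduleCat_exact_iff_function_exact S).2 hfg
      mono_f := (ModuleCat.mono_iff_injective _).2 hf
      epi_g := (ModuleCat.epi_iff_surjective _).2 hg }
  exact hS.hasProjectiveDimensionLT_X₃_iff n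
    ((IsProjective.iff_projective P).1 inferInstance)

/-- Dimension shifting along a surjection from a projective module. -/
theorem hasProjectiveDimensionLT_iff_ker {R : Type v} [Ring R] {P M : Type v}
    [AddCommGroup P] [Module R P] [AddCommGroup M] [Module R M]
    [Module.Projective R P] (g : P →ₗ[R] M) (hg : Function.Surjective g) (n : ℕ) :
    HasProjectiveDimensionLT (ModuleCat.of R M) (n + 2) ↔
      HasProjectiveDimensionLT (ModuleCat.of R (LinearMap.ker g)) (n + 1) :=
  hasProjectiveDimensionLT_iff_of_exact _ g (Submodule.injective_subtype _)
    (LinearMap.exact_subtype_ker_map g) hg n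

/-- A sequence of three elements `β, α, γ` of a ring, which is regular for the right
multiplication and commutes up to twisting, in the sense of the relations below. -/
structure TwistedRegularSequence (E : Type v) [Ring E] where
  (β α γ β₁ α₁ β₂ γ₂ α₃ γ₃ κ X Y Z : E)
  β_α : β₁ * α = α₁ * β
  β_γ : β₂ * γ = γ₂ * β
  α_γ : α₃ * γ = γ₃ * α + κ * β
  top_γ : Y * β₂ = X * α₃
  top_α : Z * β₁ = X * γ₃
  top_β : Y * γ₂ = Z * α₁ + X * κ
  regular_β₁ : ∀ u, u * β₁ = 0 → u = 0
  regular_β₂ : ∀ u, u * β₂ = 0 → u = 0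
  regular_β : ∀ u, u * β = 0 → u = 0
  regular_X : ∀ u, u * X = 0 → u = 0
  regular_α : ∀ u v, u * α = v * β → ∃ w, u = w * β₁
  regular_α₃ : ∀ u v, u * α₃ = v * β₂ → ∃ w, u = w * X
  regular_γ : ∀ u v w, u * γ = v * α + w * β → ∃ s t, u = s * α₃ + t * β₂

namespace TwistedRegularSequence

variable {E : Type v} [Ring E] (S : TwistedRegularSequence E)

/-- Right multiplication by an element, as a linear map of left modules. -/
def mulR (z : E) : E →ₗ[E] E := LinearMap.toSpanSingleton E E z

@[simp]
theorem mulR_apply (z u : E) : mulR z u = u * z := rfl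

/-- The first differential. -/
def d₁ : (E × E × E) →ₗ[E] E := (mulR S.β).coprod ((mulR S.α).coprod (mulR S.γ))

/-- The second differential. -/
def d₂ : (E × E × E) →ₗ[E] (E × E × E) :=
  (LinearMap.prod (-mulR S.α₁) (LinearMap.prod (mulR S.β₁) 0)).coprod
    ((LinearMap.prod (-mulR S.γ₂) (LinearMap.prod 0 (mulR S.β₂))).coprod
      (LinearMap.prod (-mulR S.κ) (LinearMap.prod (-mulR S.γ₃) (mulR S.α₃))))

/-- The third differential. -/
def d₃ : E →ₗ[E] (E × E × E) :=
  LinearMap.prod (mulR S.Z) (LinearMap.prod (-mulR S.Y) (mulR S.X))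

theorem d₁_apply (u v w : E) : S.d₁ (u, v, w) = u * S.β + (v * S.α + w * S.γ) := rfl

theorem d₂_apply (r s t : E) : S.d₂ (r, s, t) =
    (-(r * S.α₁) + (-(s * S.γ₂) + -(t * S.κ)), r * S.β₁ + (0 + -(t * S.γ₃)),
      0 + (s * S.β₂ + t * S.α₃)) := rfl

theorem d₃_apply (u : E) : S.d₃ u = (u * S.Z, -(u * S.Y), u * S.X) := rfl

theorem d₁_d₂ (x : E × E × E) : S.d₁ (S.d₂ x) = 0 := by
  obtain ⟨r, s, t⟩ := x
  simp only [d₂_apply, d₁_apply, add_mul, neg_mul, mul_assoc, S.β_α, S.β_γ, S.α_γ, mul_add,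
    zero_mul]
  abel

theorem d₂_d₃ (u : E) : S.d₂ (S.d₃ u) = 0 := by
  simp only [d₂_apply, d₃_apply, neg_mul, mul_assoc, S.top_α, S.top_β, S.top_γ, mul_add]
  ext <;> simp

/-- The coordinates of a syzygy are eliminated one at a time: regularity of `γ` treats the third,
then that of `α` modulo `β` the second, and finally cancelling `β` forces the first. -/
theorem exact_d₂_d₁ : Function.Exact S.d₂ S.d₁ := by
  refine fun x => ⟨fun hx => ?_, ?_⟩
  · obtain ⟨u, v, w⟩ := x
    rw [d₁_apply] at hx
    obtain ⟨t, s, rfl⟩ := S.regular_γ w (-v) (-u) (by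
      rw [← sub_eq_zero, neg_mul, neg_mul, ← hx]; abel)
    obtain ⟨r, hr⟩ := S.regular_α (v + t * S.γ₃) (-(u + s * S.γ₂ + t * S.κ)) (by
      rw [← sub_eq_zero, ← hx]
      simp only [add_mul, neg_mul, mul_assoc, S.β_γ, S.α_γ, mul_add]
      abel)
    have hv : v = r * S.β₁ - t * S.γ₃ := eq_sub_of_add_eq hr
    have hu := S.regular_β (u + r * S.α₁ + s * S.γ₂ + t * S.κ) (by
      rw [← hx, hv]
      simp only [add_mul, sub_mul, mul_assoc, S.β_α, S.β_γ, S.α_γ, mul_add]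
      abel)
    refine ⟨(r, s, t), ?_⟩
    rw [d₂_apply, hv]
    refine Prod.ext ?_ (Prod.ext ?_ ?_)
    · change -(r * S.α₁) + (-(s * S.γ₂) + -(t * S.κ)) = u
      rw [← sub_eq_zero, ← neg_eq_zero, ← hu]
      abel
    · change r * S.β₁ + (0 + -(t * S.γ₃)) = r * S.β₁ - t * S.γ₃
      abel
    · change 0 + (s * S.β₂ + t * S.α₃) = t * S.α₃ + s * S.β₂
      abel
  · rintro ⟨y, rfl⟩
    exact S.d₁_d₂ y

/-- The last two coordinates of the equation suffice: `regular_α₃` produces the preimage, and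
cancelling `β₂` and `β₁` identifies the remaining entries. -/
theorem exact_d₃_d₂ : Function.Exact S.d₃ S.d₂ := by
  refine fun x => ⟨fun hx => ?_, ?_⟩
  · obtain ⟨r, s, t⟩ := x
    rw [d₂_apply, Prod.mk_eq_zero, Prod.mk_eq_zero] at hx
    obtain ⟨-, h₂, h₃⟩ := hx
    rw [zero_add] at h₂ h₃
    obtain ⟨w, rfl⟩ := S.regular_α₃ t (-s) (by
      rw [neg_mul, eq_neg_iff_add_eq_zero, add_comm, h₃])
    have hs := S.regular_β₂ (s + w * S.Y) (by
      rw [← h₃, add_mul, mul_assoc w, mul_assoc w, S.top_γ])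
    have hr := S.regular_β₁ (r - w * S.Z) (by
      rw [← h₂, sub_mul, mul_assoc w, mul_assoc w, S.top_α, sub_eq_add_neg])
    refine ⟨w, ?_⟩
    rw [d₃_apply, sub_eq_zero.1 hr, eq_neg_of_add_eq_zero_left hs]
  · rintro ⟨y, rfl⟩
    exact S.d₂_d₃ y

theorem injective_d₃ : Function.Injective S.d₃ := by
  rw [injective_iff_map_eq_zero]
  intro u hu
  rw [d₃_apply, Prod.mk_eq_zero, Prod.mk_eq_zero] at hu
  exact S.regular_X u hu.2.2

/-- The modules in the resolution. -/
def resolutionObj (E : Type v) [Ring E] : ℕ → ModuleCat.{v} E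
  | 0 => ModuleCat.of E E
  | 1 => ModuleCat.of E (E × E × E)
  | 2 => ModuleCat.of E (E × E × E)
  | 3 => ModuleCat.of E E
  | _ + 4 => ModuleCat.of E PUnit

/-- The differentials in the resolution. -/
def resolutionMap : ∀ i, resolutionObj E (i + 1) →ₗ[E] resolutionObj E i
  | 0 => S.d₁
  | 1 => S.d₂
  | 2 => S.d₃
  | _ + 3 => 0

variable {M : Type v} [AddCommGroup M] [Module E M]

/-- The resolution by finitely generated free modules. -/
theorem isTypeFP (π : E →ₗ[E] M) (hπ : Function.Surjective π)
    (hexact : Function.Exact S.d₁ π) : IsTypeFP E (ModuleCat.of E M) := by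
  refine ⟨resolutionObj E, S.resolutionMap, π, ?_, ⟨3, ?_⟩, hπ, hexact, ?_⟩
  · rintro (_ | _ | _ | _ | _)
    · exact ⟨inferInstanceAs (Module.Finite E E), inferInstanceAs (Module.Projective E E)⟩
    · exact ⟨inferInstanceAs (Module.Finite E (E × E × E)),
        inferInstanceAs (Module.Projective E (E × E × E))⟩
    · exact ⟨inferInstanceAs (Module.Finite E (E × E × E)),
        inferInstanceAs (Module.Projective E (E × E × E))⟩
    · exact ⟨inferInstanceAs (Module.Finite E E), inferInstanceAs (Module.Projective E E)⟩
    · exact ⟨inferInstanceAs (Module.Finite E PUnit.{v + 1}), inferInstanceAs (Module.Projective E PUnit.{v + 1})⟩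
  · intro i hi
    obtain ⟨j, rfl⟩ : ∃ j, i = j + 4 := ⟨i - 4, by omega⟩
    exact inferInstanceAs (Subsingleton PUnit.{v + 1})
  · rintro (_ | _ | _ | i)
    · exact S.exact_d₂_d₁
    · exact S.exact_d₃_d₂
    · refine fun x => ⟨fun hx => ⟨0, ?_⟩, ?_⟩
      · exact (S.injective_d₃ (hx.trans (map_zero S.d₃).symm)).symm
      · rintro ⟨y, rfl⟩
        exact map_zero S.d₃
    · exact fun x => ⟨fun _ => ⟨0, rfl⟩, fun _ => rfl⟩

/-- If the resolution is minimal at a one-dimensional representation, its length is the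
projective dimension. -/
theorem projectiveDimension_eq (π : E →ₗ[E] M) (hπ : Function.Surjective π)
    (hexact : Function.Exact S.d₁ π)
    {F : Type*} [Ring F] [Nontrivial F] (χ : E →+* F)
    (hX : χ S.X = 0) (hY : χ S.Y = 0) (hZ : χ S.Z = 0) :
    projectiveDimension (ModuleCat.of E M) = 3 := by
  let f₁ : (E × E × E) →ₗ[E] LinearMap.ker π :=
    S.d₁.codRestrict _ fun x => (hexact _).2 ⟨x, rfl⟩
  have hf₁ : Function.Surjective f₁ := by
    rintro ⟨y, hy⟩
    obtain ⟨x, rfl⟩ := (hexact y).1 hy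
    exact ⟨x, rfl⟩
  have hker₁ : LinearMap.ker f₁ = LinearMap.ker S.d₁ := LinearMap.ker_codRestrict _ _ _
  let f₂ : (E × E × E) →ₗ[E] LinearMap.ker f₁ :=
    S.d₂.codRestrict _ fun x => hker₁ ▸ S.d₁_d₂ x
  have hf₂ : Function.Surjective f₂ := by
    rintro ⟨y, hy⟩
    rw [hker₁] at hy
    obtain ⟨x, rfl⟩ := (S.exact_d₂_d₁ y).1 hy
    exact ⟨x, rfl⟩
  have hexact₂ : Function.Exact S.d₃ f₂ := by
    intro x
    rw [← S.exact_d₃_d₂ x]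
    exact ⟨fun h => congrArg Subtype.val h, fun h => Subtype.ext h⟩
  have h4 : HasProjectiveDimensionLT (ModuleCat.of E M) 4 := by
    rw [hasProjectiveDimensionLT_iff_ker π hπ 2, hasProjectiveDimensionLT_iff_ker f₁ hf₁ 1,
      hasProjectiveDimensionLT_iff_of_exact S.d₃ f₂ S.injective_d₃ hexact₂ hf₂ 0,
      ← projective_iff_hasProjectiveDimensionLT_one, ← IsProjective.iff_projective]
    infer_instance
  have h3 : ¬ HasProjectiveDimensionLT (ModuleCat.of E M) 3 := by
    rw [hasProjectiveDimensionLT_iff_ker π hπ 1, hasProjectiveDimensionLT_iff_ker f₁ hf₁ 0,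
      ← projective_iff_hasProjectiveDimensionLT_one, ← IsProjective.iff_projective]
    intro hproj
    obtain ⟨s, hs⟩ := Module.projective_lifting_property f₂ LinearMap.id hf₂
    -- If the second syzygy were projective, `f₂` would split, hence so would `d₃`. A retraction
    -- writes `1` as a combination of `Z`, `Y`, `X` with coefficients on the right, which `χ` sends
    -- to `0`.
    have hsplit : (∃ l, f₂ ∘ₗ l = LinearMap.id) ↔ ∃ l, l ∘ₗ S.d₃ = LinearMap.id :=
      (hexact₂.split_tfae S.injective_d₃ hf₂).out 0 1
    obtain ⟨r, hr⟩ := hsplit.1 ⟨s, hs⟩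
    have h1 : r (S.d₃ 1) = 1 := DFunLike.congr_fun hr 1
    have h2 : S.d₃ 1 = S.Z • ((1 : E), (0 : E), (0 : E)) + (-S.Y) • ((0 : E), (1 : E), (0 : E)) +
        S.X • ((0 : E), (0 : E), (1 : E)) := by
      rw [d₃_apply]
      simp
    rw [h2, map_add, map_add, map_smul, map_smul, map_smul, smul_eq_mul, smul_eq_mul,
      smul_eq_mul] at h1
    have := congrArg χ h1
    simp [hX, hY, hZ] at this
  exact le_antisymm ((projectiveDimension_le_iff _ 3).2 h4) ((projectiveDimension_ge_iff _ 3).2 h3)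

end TwistedRegularSequence

end Resolution

/-! ### The diagonal bimodule and its resolution. -/

section Diagonal

variable {k : Type u} [Field k]

open MulOpposite

namespace IsUniversalTuple

variable {A : Type u} [Ring A] [Algebra k A] {p q : kˣ} {e : Gen → A}
  (h : IsUniversalTuple p q e)

theorem leftEntry_sub_rightEntry_mem (h : IsUniversalTuple p q e) (g : Gen) :
    leftEntry k e g - rightEntry k e g ∈ Ideal.span {alpha k e, beta k e, gamma p e} := by
  have hα : alpha k e ∈ Ideal.span {alpha k e, beta k e, gamma p e} :=
    Submodule.subset_span (by simp)
  have hβ : beta k e ∈ Ideal.span {alpha k e, beta k e, gamma p e} :=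
    Submodule.subset_span (by simp)
  have hγ : gamma p e ∈ Ideal.span {alpha k e, beta k e, gamma p e} :=
    Submodule.subset_span (by simp)
  cases g
  · exact hα
  · exact hβ
  · have := add_mem (sub_mem
      (Submodule.smul_of_tower_mem _ (p : k) (Ideal.mul_mem_left _ (leftEntry k e .a) hγ))
      (Ideal.mul_mem_left _ (leftEntry k e .c * rightEntry k e .d) hα))
      (Ideal.mul_mem_left _ ((p⁻¹ : k) • (leftEntry k e .c * rightEntry k e .c)) hβ)
    convert this using 1
    nth_rw 1 [h.isBimoduleTuple.right_c_eq]
    rw [gamma, alpha, beta]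
    abel
  · have := add_mem (sub_mem
      (Submodule.smul_of_tower_mem _ (q : k) (Ideal.mul_mem_left _ (leftEntry k e .b) hγ))
      (Ideal.mul_mem_left _ (leftEntry k e .d * rightEntry k e .d) hα))
      (Ideal.mul_mem_left _ ((p⁻¹ : k) • (leftEntry k e .d * rightEntry k e .c)) hβ)
    convert this using 1
    nth_rw 1 [h.isBimoduleTuple.right_d_eq]
    rw [gamma, alpha, beta]
    abel

/-- The Leibniz identity for `x ⊗ 1 - 1 ⊗ x` on products reduces the claim to generators. -/
theorem tmul_one_sub_one_tmul_mem (h : IsUniversalTuple p q e) (x : A) :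
    x ⊗ₜ 1 - 1 ⊗ₜ op x ∈ Ideal.span {alpha k e, beta k e, gamma p e} := by
  induction x using h.induction with
  | scalar r =>
    rw [Algebra.algebraMap_eq_smul_one, op_smul, op_one, TensorProduct.smul_tmul, sub_self]
    exact zero_mem _
  | entry g => exact h.leftEntry_sub_rightEntry_mem g
  | mul x y hx hy =>
    have := add_mem (Ideal.mul_mem_left _ (x ⊗ₜ 1) hy) (Ideal.mul_mem_left _ (1 ⊗ₜ op y) hx)
    simpa only [mul_sub, Algebra.TensorProduct.tmul_mul_tmul, one_mul, mul_one, ← op_mul,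
      sub_add_sub_cancel] using this
  | add x y hx hy =>
    rw [TensorProduct.add_tmul, op_add, TensorProduct.tmul_add, add_sub_add_comm]
    exact add_mem hx hy

attribute [local instance] TensorProduct.Algebra.module

theorem tmul_smul_one (x y : A) : (x ⊗ₜ[k] op y) • (1 : A) = x * y := by
  rw [TensorProduct.Algebra.smul_def, op_smul_eq_mul, one_mul, smul_eq_mul]

theorem leftEntry_smul (g : Gen) (x : A) : leftEntry k e g • x = e g * x := by
  rw [leftEntry, TensorProduct.Algebra.smul_def, one_smul, smul_eq_mul]

theorem rightEntry_smul (g : Gen) (x : A) : rightEntry k e g • x = x * e g := by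
  rw [rightEntry, TensorProduct.Algebra.smul_def, one_smul, op_smul_eq_mul]

variable (k A) in
/-- The multiplication map from the enveloping algebra. -/
noncomputable def augmentation : A ⊗[k] Aᵐᵒᵖ →ₗ[A ⊗[k] Aᵐᵒᵖ] A :=
  LinearMap.toSpanSingleton (A ⊗[k] Aᵐᵒᵖ) A 1

theorem zero_smul_one : (0 : A ⊗[k] Aᵐᵒᵖ) • (1 : A) = 0 :=
  map_zero (augmentation k A)

theorem sub_smul_one_tmul_mem (h : IsUniversalTuple p q e) (u : A ⊗[k] Aᵐᵒᵖ) :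
    (u • (1 : A)) ⊗ₜ 1 - u ∈ Ideal.span {alpha k e, beta k e, gamma p e} := by
  induction u using TensorProduct.induction_on with
  | zero =>
    have h1 : ((0 : A ⊗[k] Aᵐᵒᵖ) • (1 : A)) ⊗ₜ 1 - 0 ∈
        Ideal.span {alpha k e, beta k e, gamma p e} := by
      rw [zero_smul_one, TensorProduct.zero_tmul, sub_zero]
      exact zero_mem _
    exact h1
  | add u v hu hv =>
    rw [add_smul, TensorProduct.add_tmul, add_sub_add_comm]
    exact add_mem hu hv
  | tmul x y =>
    have := Ideal.mul_mem_left _ (x ⊗ₜ 1) (h.tmul_one_sub_one_tmul_mem (unop y))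
    rw [← op_unop y, tmul_smul_one]
    simpa only [mul_sub, Algebra.TensorProduct.tmul_mul_tmul, one_mul, mul_one, op_unop] using this

theorem smul_smul_one (r : k) (u : A ⊗[k] Aᵐᵒᵖ) : (r • u) • (1 : A) = r • u • (1 : A) := by
  induction u using TensorProduct.induction_on with
  | zero =>
    rw [smul_zero]
    exact zero_smul_one.trans ((congrArg (r • ·) zero_smul_one).trans (smul_zero r)).symm
  | add u v hu hv => rw [smul_add, add_smul, add_smul, smul_add, hu, hv]
  | tmul x y =>
    rw [TensorProduct.smul_tmul', TensorProduct.Algebra.smul_def, TensorProduct.Algebra.smul_def,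
      smul_assoc]

theorem gamma_smul_one (h : IsUniversalTuple p q e) : gamma p e • (1 : A) = 0 := by
  rw [gamma, IsBimoduleTuple.minor, sub_smul, smul_smul_one, mul_smul, mul_smul, rightEntry_smul,
    rightEntry_smul, leftEntry_smul, leftEntry_smul, one_mul, one_mul, h.isMatrixTuple.dc,
    smul_smul, inv_mul_cancel₀ p.ne_zero, one_smul, sub_self]

theorem augmentation_surjective : Function.Surjective (augmentation k A) := fun x =>
  ⟨x ⊗ₜ op 1, by rw [augmentation, LinearMap.toSpanSingleton_apply, tmul_smul_one, mul_one]⟩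

/-- The defining data of the resolution of the diagonal bimodule. -/
noncomputable def twistedRegularSequence (h : IsUniversalTuple p q e) :
    TwistedRegularSequence (A ⊗[k] Aᵐᵒᵖ) where
  β := beta k e
  α := alpha k e
  γ := gamma p e
  β₁ := leftEntry k e .b - (q : k) • rightEntry k e .b
  α₁ := (q : k) • leftEntry k e .a - rightEntry k e .a
  β₂ := (q : k) • leftEntry k e .b - rightEntry k e .b
  γ₂ := (q : k) • (leftEntry k e .c * rightEntry k e .d) -
    (p⁻¹ : k) • (leftEntry k e .d * rightEntry k e .c)
  α₃ := (p : k) • leftEntry k e .a - rightEntry k e .a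
  γ₃ := leftEntry k e .c * rightEntry k e .d - leftEntry k e .d * rightEntry k e .c
  κ := (q - p⁻¹ : k) • (leftEntry k e .c * rightEntry k e .c)
  X := (q : k) • (leftEntry k e .b - rightEntry k e .b)
  Y := (p * q : k) • leftEntry k e .a - rightEntry k e .a
  Z := (q : k) • (leftEntry k e .c * rightEntry k e .d) - leftEntry k e .d * rightEntry k e .c
  β_α := h.isBimoduleTuple.beta_alpha
  β_γ := h.isBimoduleTuple.beta_minor
  α_γ := h.isBimoduleTuple.alpha_minor
  top_γ := h.isBimoduleTuple.alpha_beta_top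
  top_α := h.isBimoduleTuple.minor_beta_top
  top_β := h.isBimoduleTuple.alpha_minor_top
  regular_β₁ := h.eq_zero_of_mul_beta q
  regular_β₂ := fun u hu => h.eq_zero_of_mul_beta (q⁻¹ : k) u (by
    have : leftEntry k e .b - (q⁻¹ : k) • rightEntry k e .b =
        (q⁻¹ : k) • ((q : k) • leftEntry k e .b - rightEntry k e .b) := by
      rw [smul_sub, smul_smul, inv_mul_cancel₀ q.ne_zero, one_smul]
    rw [this, mul_smul_comm, hu, smul_zero])
  regular_β := fun u hu => h.eq_zero_of_mul_beta 1 u (by rwa [one_smul])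
  regular_X := fun u hu => h.eq_zero_of_mul_beta 1 u (by
    rw [one_smul]
    rw [mul_smul_comm] at hu
    exact (smul_eq_zero_iff_right q.ne_zero).1 hu)
  regular_α := fun u v huv => by
    have := h.mem_span_beta_of_mul_alpha 1 1 u (by
      rw [one_smul, one_smul]
      exact Ideal.mem_span_singleton'.2 ⟨v, huv.symm⟩)
    rw [one_mul] at this
    obtain ⟨w, hw⟩ := Ideal.mem_span_singleton'.1 this
    exact ⟨w, hw.symm⟩
  regular_α₃ := fun u v huv => by
    have h1 : leftEntry k e .b - (q⁻¹ : k) • rightEntry k e .b =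
        (q⁻¹ : k) • ((q : k) • leftEntry k e .b - rightEntry k e .b) := by
      rw [smul_sub, smul_smul, inv_mul_cancel₀ q.ne_zero, one_smul]
    -- The choice `r = q⁻¹` makes the resulting twist `r q` equal to `1`, so the conclusion concerns
    -- `beta` itself, a scalar multiple of `X`.
    have := h.mem_span_beta_of_mul_alpha (q⁻¹ : k) (p : k) u
      (Ideal.mem_span_singleton'.2 ⟨(q : k) • v, by
        rw [h1, smul_mul_smul_comm, mul_inv_cancel₀ q.ne_zero, one_smul, huv]⟩)
    rw [inv_mul_cancel₀ q.ne_zero, one_smul] at this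
    obtain ⟨w, hw⟩ := Ideal.mem_span_singleton'.1 this
    exact ⟨(q⁻¹ : k) • w, by
      rw [smul_mul_smul_comm, inv_mul_cancel₀ q.ne_zero, one_smul, hw]⟩
  regular_γ := fun u v w huv => by
    obtain ⟨s, t, hst⟩ := Submodule.mem_span_pair.1
      (h.mem_of_mul_gamma (Submodule.mem_span_pair.2 ⟨v, w, huv.symm⟩))
    exact ⟨s, t, hst.symm⟩

theorem exact_augmentation (h : IsUniversalTuple p q e) :
    Function.Exact h.twistedRegularSequence.d₁ (augmentation k A) := by
  refine fun u => ⟨fun hu => ?_, ?_⟩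
  · rw [augmentation, LinearMap.toSpanSingleton_apply] at hu
    have := h.sub_smul_one_tmul_mem u
    rw [hu, TensorProduct.zero_tmul, sub_mem_comm_iff, sub_zero] at this
    obtain ⟨s, t, r, hstr⟩ := Submodule.mem_span_triple.1 this
    refine ⟨(t, s, r), ?_⟩
    rw [TwistedRegularSequence.d₁_apply, ← hstr]
    change t * beta k e + (s * alpha k e + r * gamma p e) = _
    simp only [smul_eq_mul]
    abel
  · rintro ⟨⟨t, s, r⟩, rfl⟩
    rw [TwistedRegularSequence.d₁_apply, augmentation, LinearMap.toSpanSingleton_apply]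
    change (t * beta k e + (s * alpha k e + r * gamma p e)) • (1 : A) = 0
    rw [add_smul, add_smul, mul_smul, mul_smul, mul_smul, h.gamma_smul_one, alpha, beta, sub_smul,
      sub_smul, leftEntry_smul, leftEntry_smul, rightEntry_smul, rightEntry_smul]
    simp

/-- The one-dimensional bimodule detecting the top cohomology. -/
theorem isBimoduleTuple_character (p q : kˣ) :
    IsBimoduleTuple (E := k) p q
      (fun | .a => 1 | .b => 0 | .c => 0 | .d => 1)
      (fun | .a => (p * q : k) | .b => 0 | .c => 0 | .d => (p * q : k)⁻¹) where
  left := by constructor <;> simp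
  right := by
    constructor <;> apply unop_injective <;> simp
    · field_simp
    · field_simp
  comm i j := mul_comm _ _

/-- The Hochschild cohomological dimension is three. -/
theorem hochschildCohomologicalDimension_eq (h : IsUniversalTuple p q e) :
    hochschildCohomologicalDimension k A = 3 := by
  refine TwistedRegularSequence.projectiveDimension_eq h.twistedRegularSequence (augmentation k A)
    augmentation_surjective h.exact_augmentation
    (h.envLift (isBimoduleTuple_character p q) : A ⊗[k] Aᵐᵒᵖ →+* k) ?_ ?_ ?_ <;>
  -- `X` and `Z` vanish because `b` and `c` are sent to `0` on both sides. `Y` vanishes because the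
  -- right `a` is sent to `pq` times the image of the left one.
  simp [twistedRegularSequence]

theorem isHomologicallySmooth (h : IsUniversalTuple p q e) : IsHomologicallySmooth k A :=
  TwistedRegularSequence.isTypeFP h.twistedRegularSequence (augmentation k A)
    augmentation_surjective h.exact_augmentation

end IsUniversalTuple

end Diagonal

/-! ### The presented algebra has the universal property. -/

section Standard

variable {k : Type u} [Field k]

namespace OSL2

/-- The image of a generator in `OSL2 p q`. -/
noncomputable def entry (p q : kˣ) (g : Gen) : OSL2 p q := RingQuot.mkAlgHom k (Rel p q) (gen k g)

theorem isMatrixTuple_entry (p q : kˣ) : IsMatrixTuple p q (entry p q) where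
  ba := by simpa [entry] using RingQuot.mkAlgHom_rel k (Rel.ba (p := p) (q := q))
  ca := by simpa [entry] using RingQuot.mkAlgHom_rel k (Rel.ca (p := p) (q := q))
  db := by simpa [entry] using RingQuot.mkAlgHom_rel k (Rel.db (p := p) (q := q))
  dc := by simpa [entry] using RingQuot.mkAlgHom_rel k (Rel.dc (p := p) (q := q))
  bc := by simpa [entry] using RingQuot.mkAlgHom_rel k (Rel.bc (p := p) (q := q))
  ad := by
    have := RingQuot.mkAlgHom_rel k (Rel.ad (p := p) (q := q))
    simp only [map_sub, map_mul, map_smul, map_one, sub_eq_iff_eq_add] at this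
    simpa [entry] using this
  da := by
    have := RingQuot.mkAlgHom_rel k (Rel.da (p := p) (q := q))
    simp only [map_sub, map_mul, map_smul, map_one, sub_eq_iff_eq_add] at this
    simpa [entry] using this

theorem isUniversalTuple_entry (p q : kˣ) : IsUniversalTuple p q (entry p q) where
  isMatrixTuple := isMatrixTuple_entry p q
  exists_lift x hx := by
    refine ⟨RingQuot.liftAlgHom k ⟨FreeAlgebra.lift k x, ?_⟩, ?_⟩
    · intro y z h
      cases h <;> simp [hx.ba, hx.ca, hx.db, hx.dc, hx.bc, hx.ad, hx.da]
    · intro g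
      simp [entry]
  subalgebra_eq_top S h := by
    rw [eq_top_iff]
    rintro x -
    obtain ⟨y, rfl⟩ := RingQuot.mkAlgHom_surjective k (Rel p q) x
    induction y using FreeAlgebra.induction with
    | grade0 r => rw [AlgHom.commutes]; exact S.algebraMap_mem r
    | grade1 g => exact h g
    | mul x y hx hy => rw [map_mul]; exact S.mul_mem hx hy
    | add x y hx hy => rw [map_add]; exact S.add_mem hx hy

end OSL2

end Standard

end BraidedSL2

theorem corollary6p9 {k : Type*} [Field k] (p q : kˣ) :
    BraidedSL2.hochschildCohomologicalDimension k (BraidedSL2.OSL2 p q) = 3 ∧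
      BraidedSL2.IsHomologicallySmooth k (BraidedSL2.OSL2 p q) :=
  ⟨(BraidedSL2.OSL2.isUniversalTuple_entry p q).hochschildCohomologicalDimension_eq,
    (BraidedSL2.OSL2.isUniversalTuple_entry p q).isHomologicallySmooth⟩
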